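/- Let $(M,g)$ be a four-dimensional spacetime, that is, a smooth four-manifold with a smooth Lorentzian metric, let $U:M\to\mathbb R$ be smooth and let $\hat g_{ab}=e^{2U}g_{ab}$. Let $C_{abcd}$ be the Weyl tensor of $g$, put $I_1=C_{abcd}C^{abcd}$, and, where $I_1\neq 0$, let $$C^2_{abcd}=\frac{1}{\sqrt{I_1}}\,C_{ab}{}^{ef}C_{efcd}$$ (with the principal complex square root, as $I_1$ may be negative). Put $S_{abcd}=C^2_{abcd}-C^2_{a[bcd]}$, $S_{bd}=S^{a}{}_{bad}$, $S=S^b{}_b$, and define $W_{abcd}$ by removing the traces of $S_{abcd}$: $$W_{abcd}=S_{abcd}-\tfrac12\left(g_{ac}S_{bd}-g_{ad}S_{bc}+g_{bd}S_{ac}-g_{bc}S_{ad}\right)+\tfrac16\,S\left(g_{ac}g_{bd}-g_{ad}g_{bc}\right).$$ Set, with $;$ the Levi-Civita covariant derivative of $g$ and with indices raised by $g$, $${}^WI_1=W_{abcd}W^{abcd},\quad {}^WI_3=W_{abcd;e}W^{abcd;e},\quad {}^WI_{3a}=W_{abcd;e}W^{ebcd;a},\quad {}^WI_5={}^WI_{1;a}\,{}^WI_1{}^{;a},$$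 $${}^WJ_4=6\,{}^WI_1\,{}^WI_3-16\,{}^WI_1\,{}^WI_{3a}+{}^WI_5 ,$$ and let $\hat W_{abcd}$, ${}^W\hat J_4$ be the same objects built from $\hat g$. Then at every point of $M$ with $I_1\neq0$: 1. the tensor field $W_{abcd}$ is smooth and Weyl-like: $W_{abcd}=-W_{bacd}=-W_{abdc}=W_{cdab}$, $W_{a[bcd]}=0$ and $W^a{}_{bac}=0$; 2. $W$ is conformally covariant: $\hat W_{abcd}=e^{2U}W_{abcd}$; 3. ${}^W\hat J_4=e^{-10U}\,{}^WJ_4$. -/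

import Mathlib

open scoped Manifold ContDiff

noncomputable section

namespace ConformalInvariants

/-- The model space `ℝ⁴`. -/
abbrev E4 : Type := EuclideanSpace ℝ (Fin 4)

/-- Components `T_{abcd}` of a covariant tensor of rank four at a point, with values in `V`. -/
abbrev Tensor4 (V : Type*) : Type _ := Fin 4 → Fin 4 → Fin 4 → Fin 4 → V

/-! ### Spacetimes -/

/-- The component `g(∂_i, ∂_j)` at the point with coordinates `y` in the chart `φ`, where
`∂_i = d(φ⁻¹)_y (e_i)` are the coordinate vector fields. -/
def metricComponent {M : Type*} [TopologicalSpace M] [ChartedSpace E4 M]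
    (g : ∀ x : M, TangentSpace (𝓡 4) x →ₗ[ℝ] TangentSpace (𝓡 4) x →ₗ[ℝ] ℝ)
    (φ : OpenPartialHomeomorph M E4) (i j : Fin 4) (y : E4) : ℝ :=
  g (φ.symm y)
    (mfderiv (𝓡 4) (𝓡 4) φ.symm y (EuclideanSpace.single i (1 : ℝ) : E4))
    (mfderiv (𝓡 4) (𝓡 4) φ.symm y (EuclideanSpace.single j (1 : ℝ) : E4))

/-- A smooth Lorentzian metric (signature `(-,+,+,+)`) on a smooth four-manifold: a symmetric
bilinear form on every tangent space that has a pseudo-orthonormal basis, and whose components are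
smooth in every chart of the smooth structure. -/
structure LorentzMetric (M : Type*) [TopologicalSpace M] [ChartedSpace E4 M]
    [IsManifold (𝓡 4) ∞ M] where
  /-- the bilinear form on each tangent space -/
  form : ∀ x : M, TangentSpace (𝓡 4) x →ₗ[ℝ] TangentSpace (𝓡 4) x →ₗ[ℝ] ℝ
  symm : ∀ (x : M) (v w : TangentSpace (𝓡 4) x), form x v w = form x w v
  lorentzian : ∀ x : M, ∃ b : Module.Basis (Fin 4) ℝ (TangentSpace (𝓡 4) x), ∀ i j : Fin 4,
    form x (b i) (b j) = if i = j then (if i = 0 then -1 else 1) else 0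
  smooth : ∀ φ ∈ IsManifold.maximalAtlas (𝓡 4) ∞ M, ∀ i j : Fin 4,
    ContDiffOn ℝ ∞ (metricComponent form φ i j) φ.target

/-- The component matrix `g_{ij}` of the metric in the chart `φ`, as a function of the
coordinates. -/
def LorentzMetric.inChart {M : Type*} [TopologicalSpace M] [ChartedSpace E4 M]
    [IsManifold (𝓡 4) ∞ M] (g : LorentzMetric M) (φ : OpenPartialHomeomorph M E4) (y : E4) :
    Matrix (Fin 4) (Fin 4) ℝ :=
  Matrix.of fun i j => metricComponent g.form φ i j y

/-! ### Algebra of tensors of rank four at a point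

Here `g` is the component matrix `g_{ab}` at the point, and `g⁻¹` its inverse `g^{ab}`. -/

section Pointwise

variable {V : Type*} [AddCommGroup V] [Module ℝ V]

/-- The trace two-tensor `g^{ac} T_{abcd}`, that is `T^a_{bad}`. -/
def trace13 (g : Matrix (Fin 4) (Fin 4) ℝ) (T : Tensor4 V) (b d : Fin 4) : V :=
  ∑ a, ∑ c, g⁻¹ a c • T a b c d

/-- The scalar trace `g^{ac} g^{bd} T_{abcd}`. -/
def scalarTrace (g : Matrix (Fin 4) (Fin 4) ℝ) (T : Tensor4 V) : V :=
  ∑ b, ∑ d, g⁻¹ b d • trace13 g T b d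

/-- The trace-free part of a curvature-like tensor in dimension four: subtract the products of
the trace two-tensor with the metric. Applied to the Riemann tensor, it gives the Weyl tensor. -/
def weylPart (g : Matrix (Fin 4) (Fin 4) ℝ) (T : Tensor4 V) : Tensor4 V := fun a b c d =>
  T a b c d
    - (1 / 2 : ℝ) • (g a c • trace13 g T b d - g a d • trace13 g T b c
        + g b d • trace13 g T a c - g b c • trace13 g T a d)
    + ((1 / 6 : ℝ) * (g a c * g b d - g a d * g b c)) • scalarTrace g T

/-- The antisymmetrisation `T_{a[bcd]}` over the last three indices. -/
def antisymBCD (T : Tensor4 V) : Tensor4 V := fun a b c d =>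
  (1 / 6 : ℝ) • (T a b c d + T a c d b + T a d b c - T a b d c - T a c b d - T a d c b)

/-- Weyl-like tensors: those with the index symmetries of the Weyl tensor, including the algebraic
Bianchi identity `T_{a[bcd]} = 0` and the trace-free condition `T^a_{bad} = 0`. -/
structure IsWeylLike (g : Matrix (Fin 4) (Fin 4) ℝ) (T : Tensor4 V) : Prop where
  antisymm_left : ∀ a b c d, T b a c d = -T a b c d
  antisymm_right : ∀ a b c d, T a b d c = -T a b c d
  pair_symm : ∀ a b c d, T c d a b = T a b c d
  bianchi : ∀ a b c d, antisymBCD T a b c d = 0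
  traceFree : ∀ b d, trace13 g T b d = 0

end Pointwise

/-! ### Tensor calculus in a coordinate domain

From here on `g : E4 → Matrix (Fin 4) (Fin 4) ℝ` is the component matrix of a metric as a function
of the coordinates. -/

/-- The partial derivative `∂_i f`. -/
def pderiv {V : Type*} [NormedAddCommGroup V] [NormedSpace ℝ V] (i : Fin 4) (f : E4 → V)
    (y : E4) : V :=
  fderiv ℝ f y (EuclideanSpace.single i (1 : ℝ))

/-- The Christoffel symbols `Γ^k_{ij}` of the Levi-Civita connection. -/
def christoffel (g : E4 → Matrix (Fin 4) (Fin 4) ℝ) (k i j : Fin 4) (y : E4) : ℝ :=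
  (1 / 2 : ℝ) * ∑ l, (g y)⁻¹ k l *
    (pderiv i (fun z => g z l j) y + pderiv j (fun z => g z i l) y - pderiv l (fun z => g z i j) y)

/-- The curvature `R^a_{bcd} = ∂_c Γ^a_{db} - ∂_d Γ^a_{cb} + Γ^a_{ce} Γ^e_{db} - Γ^a_{de} Γ^e_{cb}`. -/
def riemannUp (g : E4 → Matrix (Fin 4) (Fin 4) ℝ) (a b c d : Fin 4) (y : E4) : ℝ :=
  pderiv c (christoffel g a d b) y - pderiv d (christoffel g a c b) y
    + ∑ e, (christoffel g a c e y * christoffel g e d b y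
        - christoffel g a d e y * christoffel g e c b y)

/-- The Riemann tensor `R_{abcd}`. -/
def riemann (g : E4 → Matrix (Fin 4) (Fin 4) ℝ) (y : E4) : Tensor4 ℝ := fun a b c d =>
  ∑ f, g y a f * riemannUp g f b c d y

/-- The Weyl tensor `C_{abcd}`. -/
def weyl (g : E4 → Matrix (Fin 4) (Fin 4) ℝ) (y : E4) : Tensor4 ℝ :=
  weylPart (g y) (riemann g y)

/-- The product `C_{ab}^{ef} C_{efcd}`. -/
def weylProduct (g : E4 → Matrix (Fin 4) (Fin 4) ℝ) (y : E4) : Tensor4 ℝ := fun a b c d =>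
  ∑ e, ∑ f, ∑ p, ∑ q, (g y)⁻¹ e p * (g y)⁻¹ f q * weyl g y a b p q * weyl g y e f c d

/-- The invariant `I₁ = C_{abcd} C^{abcd}`. -/
def I1 (g : E4 → Matrix (Fin 4) (Fin 4) ℝ) (y : E4) : ℝ :=
  ∑ a, ∑ b, ∑ c, ∑ d, ∑ p, ∑ q, ∑ r, ∑ s,
    (g y)⁻¹ a p * (g y)⁻¹ b q * (g y)⁻¹ c r * (g y)⁻¹ d s * weyl g y a b c d * weyl g y p q r s

/-- The normalised square `C²_{abcd} = (1 / √I₁) C_{ab}^{ef} C_{efcd}` of the Weyl tensor, with the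
principal complex square root, as `I₁` may be negative. -/
def weylSq (g : E4 → Matrix (Fin 4) (Fin 4) ℝ) (y : E4) : Tensor4 ℂ := fun a b c d =>
  (1 / Complex.sqrt (I1 g y : ℂ)) * (weylProduct g y a b c d : ℂ)

/-- The tensor `W_{abcd}`: remove from `C²_{abcd}` first `C²_{a[bcd]}` and then the traces. -/
def W (g : E4 → Matrix (Fin 4) (Fin 4) ℝ) (y : E4) : Tensor4 ℂ :=
  weylPart (g y) fun a b c d => weylSq g y a b c d - antisymBCD (weylSq g y) a b c d

/-- The covariant derivative `T_{abcd;e}` of a covariant tensor field of rank four. -/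
def covDeriv (g : E4 → Matrix (Fin 4) (Fin 4) ℝ) (T : E4 → Tensor4 ℂ) (a b c d e : Fin 4)
    (y : E4) : ℂ :=
  pderiv e (fun z => T z a b c d) y
    - ∑ f, ((christoffel g f e a y : ℂ) * T y f b c d + (christoffel g f e b y : ℂ) * T y a f c d
        + (christoffel g f e c y : ℂ) * T y a b f d + (christoffel g f e d y : ℂ) * T y a b c f)

/-- `ᵂI₁ = W_{abcd} W^{abcd}`. -/
def WI1 (g : E4 → Matrix (Fin 4) (Fin 4) ℝ) (y : E4) : ℂ :=
  ∑ a, ∑ b, ∑ c, ∑ d, ∑ p, ∑ q, ∑ r, ∑ s,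
    (((g y)⁻¹ a p * (g y)⁻¹ b q * (g y)⁻¹ c r * (g y)⁻¹ d s : ℝ) : ℂ) *
      (W g y a b c d * W g y p q r s)

/-- `ᵂI₃ = W_{abcd;e} W^{abcd;e}`. -/
def WI3 (g : E4 → Matrix (Fin 4) (Fin 4) ℝ) (y : E4) : ℂ :=
  ∑ a, ∑ b, ∑ c, ∑ d, ∑ e, ∑ p, ∑ q, ∑ r, ∑ s, ∑ t,
    (((g y)⁻¹ a p * (g y)⁻¹ b q * (g y)⁻¹ c r * (g y)⁻¹ d s * (g y)⁻¹ e t : ℝ) : ℂ) *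
      (covDeriv g (W g) a b c d e y * covDeriv g (W g) p q r s t y)

/-- `ᵂI₃ₐ = W_{abcd;e} W^{ebcd;a}`. -/
def WI3a (g : E4 → Matrix (Fin 4) (Fin 4) ℝ) (y : E4) : ℂ :=
  ∑ a, ∑ b, ∑ c, ∑ d, ∑ e, ∑ p, ∑ q, ∑ r, ∑ s, ∑ t,
    (((g y)⁻¹ a p * (g y)⁻¹ b q * (g y)⁻¹ c r * (g y)⁻¹ d s * (g y)⁻¹ e t : ℝ) : ℂ) *
      (covDeriv g (W g) a b c d e y * covDeriv g (W g) t q r s p y)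

/-- `ᵂI₅ = ᵂI_{1;a} ᵂI₁^{;a}`. -/
def WI5 (g : E4 → Matrix (Fin 4) (Fin 4) ℝ) (y : E4) : ℂ :=
  ∑ a, ∑ b, ((g y)⁻¹ a b : ℂ) * (pderiv a (WI1 g) y * pderiv b (WI1 g) y)

/-- `ᵂJ₄ = 6 ᵂI₁ ᵂI₃ - 16 ᵂI₁ ᵂI₃ₐ + ᵂI₅`. -/
def WJ4 (g : E4 → Matrix (Fin 4) (Fin 4) ℝ) (y : E4) : ℂ :=
  6 * WI1 g y * WI3 g y - 16 * WI1 g y * WI3a g y + WI5 g y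

end ConformalInvariants

end

/-! Everything is local, so the argument runs in a chart, with the metric as a matrix field `g` and
`g' = e^{2u} g`.

Under the conformal change the Riemann tensor changes, up to the factor `e^{2u}`, by a
Kulkarni–Nomizu product with the metric (`ConformalOn.riemann_eq`), and removing traces kills such
products (`weylPart_kulkarniNomizu`). So `C` scales by `e^{2u}`, the product `C_{ab}^{ef} C_{efcd}`
is unchanged, `I₁` scales by `e^{-4u}`, and dividing by `√I₁` restores weight `e^{2u}`. Since `I₁`
is real and nonzero, the branch cut of the complex square root does no harm to smoothness. The Weyl
symmetries of `W` are forced by its construction.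

For `ᵂJ₄`, write `D = ∇W`, `v = du`. Then `∇'W' = e^{2u}(D + S)`, where `S` is linear in `v` and `W`
(`ConformalOn.covDeriv_eq`, `coordShift`). In a complex frame with `g⁻¹ = E Eᵀ` all contractions
become Euclidean ones on `ℂ⁴`. The essential input is special to dimension four: a Weyl-like `T`
satisfies `T_{abcd} T_{ebcd} = ¼ |T|² δ_{ae}` (`IsEuclideanWeyl.sum_mul_self_eq`). Polarised, it
relates the contractions of `D` with `v` and `W`, leaving two: `P = D_{abcde} v_e W_{abcd}` and `Q =
D_{abcde} v_a W_{ebcd}`. One finds `⟨D, S⟩ = -8Q` and `⟨D, swap S⟩ = -3Q - P/2`, where `swap`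
exchanges the first and the derivative index. The ratio `6 : 16` is the one that eliminates `Q`, so
that `6 ᵂI₃ - 16 ᵂI₃ₐ` changes, apart from its weight, by `16P - 16 |W|² |v|²`
(`six_inner5_sub_sixteen_inner5_swapAE`).

On the other side, `d ᵂI₁` becomes `e^{-4u}(d ᵂI₁ - 4 ᵂI₁ v)` and `⟨d ᵂI₁, v⟩ = 2P`, so `ᵂI₅`
changes by `-16 ᵂI₁ P + 16 ᵂI₁² |v|²`. Multiplied by `ᵂI₁ = |W|²`, the first change is exactly the
opposite of the second, and only the factor `e^{-10u}` remains. -/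

open scoped Topology
noncomputable section
namespace ConformalInvariants

/-! ### Partial derivatives in coordinates. -/

section PartialDerivatives

variable {V : Type*} [NormedAddCommGroup V] [NormedSpace ℝ V]

theorem pderiv_congr {i : Fin 4} {f h : E4 → V} {y : E4} (e : f =ᶠ[𝓝 y] h) :
    pderiv i f y = pderiv i h y := by
  simp only [pderiv, e.fderiv_eq]

theorem pderiv_add {i : Fin 4} {f h : E4 → V} {y : E4} (hf : DifferentiableAt ℝ f y)
    (hh : DifferentiableAt ℝ h y) :
    pderiv i (fun z => f z + h z) y = pderiv i f y + pderiv i h y := by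
  simp [pderiv, fderiv_fun_add hf hh]

theorem pderiv_sub {i : Fin 4} {f h : E4 → V} {y : E4} (hf : DifferentiableAt ℝ f y)
    (hh : DifferentiableAt ℝ h y) :
    pderiv i (fun z => f z - h z) y = pderiv i f y - pderiv i h y := by
  simp [pderiv, fderiv_fun_sub hf hh]

theorem pderiv_neg {i : Fin 4} {f : E4 → V} {y : E4} :
    pderiv i (fun z => -f z) y = -pderiv i f y := by
  simp [pderiv, fderiv_fun_neg]

theorem pderiv_const {i : Fin 4} {c : V} {y : E4} : pderiv i (fun _ => c) y = 0 := by
  simp [pderiv]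

theorem pderiv_sum {ι : Type*} {s : Finset ι} {i : Fin 4} {f : ι → E4 → V} {y : E4}
    (hf : ∀ k ∈ s, DifferentiableAt ℝ (f k) y) :
    pderiv i (fun z => ∑ k ∈ s, f k z) y = ∑ k ∈ s, pderiv i (f k) y := by
  simp [pderiv, fderiv_fun_sum hf]

theorem pderiv_mul {𝔸 : Type*} [NormedCommRing 𝔸] [NormedAlgebra ℝ 𝔸] {i : Fin 4}
    {f h : E4 → 𝔸} {y : E4}
    (hf : DifferentiableAt ℝ f y) (hh : DifferentiableAt ℝ h y) :
    pderiv i (fun z => f z * h z) y = pderiv i f y * h y + f y * pderiv i h y := by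
  simp [pderiv, fderiv_fun_mul hf hh]; ring

theorem pderiv_const_mul {𝔸 : Type*} [NormedCommRing 𝔸] [NormedAlgebra ℝ 𝔸] {i : Fin 4} {c : 𝔸}
    {f : E4 → 𝔸} {y : E4} (hf : DifferentiableAt ℝ f y) :
    pderiv i (fun z => c * f z) y = c * pderiv i f y := by
  rw [pderiv_mul (by fun_prop) hf, pderiv_const]; ring

theorem pderiv_ofReal {i : Fin 4} {f : E4 → ℝ} {y : E4} (hf : DifferentiableAt ℝ f y) :
    pderiv i (fun z => (f z : ℂ)) y = ((pderiv i f y : ℝ) : ℂ) := by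
  have := (Complex.ofRealCLM.hasFDerivAt (x := f y)).comp y hf.hasFDerivAt
  have h2 : fderiv ℝ (fun z => (f z : ℂ)) y = _ := this.fderiv
  simp [pderiv, h2]

theorem pderiv_exp_two_mul {i : Fin 4} {u : E4 → ℝ} {y : E4} (hu : DifferentiableAt ℝ u y) :
    pderiv i (fun z => Real.exp (2 * u z)) y = Real.exp (2 * u y) * (2 * pderiv i u y) := by
  have h := ((hu.hasFDerivAt.const_mul 2).exp).fderiv
  simp [pderiv, h]

theorem contDiffAt_pderiv {i : Fin 4} {f : E4 → V} {y : E4} (hf : ContDiffAt ℝ ∞ f y) :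
    ContDiffAt ℝ ∞ (pderiv i f) y := by
  have : ContDiffAt ℝ ∞ (fderiv ℝ f) y := hf.fderiv_right (by simp)
  exact this.clm_apply contDiffAt_const

theorem contDiffAt_ofReal {f : E4 → ℝ} {y : E4} (hf : ContDiffAt ℝ ∞ f y) :
    ContDiffAt ℝ ∞ (fun z => (f z : ℂ)) y :=
  Complex.ofRealCLM.contDiff.contDiffAt.comp y hf

theorem pderiv_comm {i j : Fin 4} {f : E4 → V} {y : E4} (hf : ContDiffAt ℝ ∞ f y) :
    pderiv i (pderiv j f) y = pderiv j (pderiv i f) y := by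
  have hs : IsSymmSndFDerivAt ℝ f y := hf.isSymmSndFDerivAt (by
    simpa using WithTop.coe_le_coe.2 (le_top : (2 : ℕ∞) ≤ ⊤))
  have hd : DifferentiableAt ℝ (fderiv ℝ f) y :=
    (hf.fderiv_right (m := ∞) (by simp)).differentiableAt (by simp)
  have key : ∀ k l : Fin 4, pderiv k (pderiv l f) y =
      fderiv ℝ (fderiv ℝ f) y (EuclideanSpace.single k 1) (EuclideanSpace.single l 1) := by
    intro k l
    have := (hd.hasFDerivAt.clm_apply
      (hasFDerivAt_const (EuclideanSpace.single l (1 : ℝ)) y)).fderiv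
    change fderiv ℝ (fun z => fderiv ℝ f z (EuclideanSpace.single l (1 : ℝ))) y _ = _
    rw [this]; simp
  rw [key, key]
  exact hs _ _

end PartialDerivatives

/-! ### Metric matrix fields, their inverses and the pairing of covectors. -/

theorem contDiffAt_det {y : E4} {h : E4 → Matrix (Fin 4) (Fin 4) ℝ}
    (hh : ∀ i j, ContDiffAt ℝ ∞ (fun z => h z i j) y) : ContDiffAt ℝ ∞ (fun z => (h z).det) y := by
  simp only [Matrix.det_apply']
  refine ContDiffAt.sum fun σ _ => contDiffAt_const.mul ?_
  exact contDiffAt_prod fun i _ => hh _ _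

/-- A field of symmetric, nondegenerate matrices on an open set, with smooth components. -/
structure SmoothMetricOn (O : Set E4) (g : E4 → Matrix (Fin 4) (Fin 4) ℝ) : Prop where
  isOpen : IsOpen O
  smooth : ∀ y ∈ O, ∀ i j, ContDiffAt ℝ ∞ (fun z => g z i j) y
  symm : ∀ y ∈ O, ∀ i j, g y i j = g y j i
  nondeg : ∀ y ∈ O, IsUnit (g y).det

/-- The Christoffel symbols of the first kind `Γ_{a,ij}`. -/
def christoffelFirst (g : E4 → Matrix (Fin 4) (Fin 4) ℝ) (a i j : Fin 4) (y : E4) : ℝ :=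
  (1 / 2 : ℝ) *
    (pderiv i (fun z => g z a j) y + pderiv j (fun z => g z i a) y - pderiv a (fun z => g z i j) y)

theorem christoffel_eq (g : E4 → Matrix (Fin 4) (Fin 4) ℝ) (k i j : Fin 4) (y : E4) :
    christoffel g k i j y = ∑ l, (g y)⁻¹ k l * christoffelFirst g l i j y := by
  simp only [christoffel, christoffelFirst, Finset.mul_sum]
  exact Finset.sum_congr rfl fun l _ => by ring

theorem sum_mul_inv {g : Matrix (Fin 4) (Fin 4) ℝ} (h : IsUnit g.det) (a b : Fin 4) :
    ∑ k, g a k * g⁻¹ k b = if a = b then 1 else 0 := by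
  rw [← Matrix.mul_apply, Matrix.mul_nonsing_inv _ h, Matrix.one_apply]

theorem sum_inv_mul {g : Matrix (Fin 4) (Fin 4) ℝ} (h : IsUnit g.det) (a b : Fin 4) :
    ∑ k, g⁻¹ a k * g k b = if a = b then 1 else 0 := by
  rw [← Matrix.mul_apply, Matrix.nonsing_inv_mul _ h, Matrix.one_apply]

theorem inv_symm {g : Matrix (Fin 4) (Fin 4) ℝ} (h : ∀ i j, g i j = g j i) (i j : Fin 4) :
    g⁻¹ i j = g⁻¹ j i := by
  have : g.transpose = g := by ext i j; exact h j i
  conv_lhs => rw [← this, ← Matrix.transpose_nonsing_inv]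
  rfl

/-- The bilinear form `h^{ef} α_e β_f`. -/
def dot (h : Matrix (Fin 4) (Fin 4) ℝ) (α β : Fin 4 → ℝ) : ℝ := ∑ e, ∑ f, h e f * (α e * β f)

section Dot
variable (h : Matrix (Fin 4) (Fin 4) ℝ) (α β γ : Fin 4 → ℝ) (c : ℝ)

theorem dot_add_left : dot h (α + β) γ = dot h α γ + dot h β γ := by
  simp [dot, add_mul, mul_add, Finset.sum_add_distrib]

theorem dot_sub_left : dot h (α - β) γ = dot h α γ - dot h β γ := by
  simp [dot, sub_mul, mul_sub, Finset.sum_sub_distrib]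

theorem dot_smul_left : dot h (c • α) γ = c * dot h α γ := by
  simp only [dot, Finset.mul_sum, Pi.smul_apply, smul_eq_mul]
  exact Finset.sum_congr rfl fun _ _ => Finset.sum_congr rfl fun _ _ => by ring

theorem dot_comm {h : Matrix (Fin 4) (Fin 4) ℝ} (hs : ∀ i j, h i j = h j i) :
    dot h α β = dot h β α := by
  unfold dot
  rw [Finset.sum_comm]
  exact Finset.sum_congr rfl fun i _ => Finset.sum_congr rfl fun j _ => by rw [hs j i]; ring

theorem dot_add_right : dot h γ (α + β) = dot h γ α + dot h γ β := by
  simp [dot, mul_add, Finset.sum_add_distrib]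

theorem dot_sub_right : dot h γ (α - β) = dot h γ α - dot h γ β := by
  simp [dot, mul_sub, Finset.sum_sub_distrib]

theorem dot_smul_right : dot h γ (c • α) = c * dot h γ α := by
  simp only [dot, Finset.mul_sum, Pi.smul_apply, smul_eq_mul]
  exact Finset.sum_congr rfl fun _ _ => Finset.sum_congr rfl fun _ _ => by ring

theorem dot_smul_matrix : dot (c • h) α β = c * dot h α β := by
  simp only [dot, Finset.mul_sum, Matrix.smul_apply, smul_eq_mul]
  exact Finset.sum_congr rfl fun _ _ => Finset.sum_congr rfl fun _ _ => by ring

theorem dot_inv_left {g : Matrix (Fin 4) (Fin 4) ℝ} (hg : IsUnit g.det)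
    (a : Fin 4) : dot g⁻¹ (g a) β = β a := by
  unfold dot
  rw [Finset.sum_comm]
  have : ∀ f, ∑ e, g⁻¹ e f * (g a e * β f) = (if a = f then 1 else 0) * β f := fun f => by
    rw [← sum_mul_inv hg, Finset.sum_mul]
    exact Finset.sum_congr rfl fun e _ => by ring
  simp [this]

end Dot

/-! ### Christoffel symbols and the symmetries of the Riemann tensor. -/

namespace SmoothMetricOn

variable {O : Set E4} {g : E4 → Matrix (Fin 4) (Fin 4) ℝ} (hg : SmoothMetricOn O g) {y : E4}
  (hy : y ∈ O)
include hg hy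

theorem eventually {p : E4 → Prop} (h : ∀ z ∈ O, p z) : ∀ᶠ z in 𝓝 y, p z :=
  Filter.eventually_of_mem (hg.isOpen.mem_nhds hy) h

theorem pderiv_congr {V : Type*} [NormedAddCommGroup V] [NormedSpace ℝ V] {i : Fin 4}
    {f h : E4 → V} (e : ∀ z ∈ O, f z = h z) : pderiv i f y = pderiv i h y :=
  ConformalInvariants.pderiv_congr (hg.eventually hy e)

theorem differentiable (i j : Fin 4) : DifferentiableAt ℝ (fun z => g z i j) y :=
  (hg.smooth y hy i j).differentiableAt (by simp)

theorem smooth_inv (i j : Fin 4) : ContDiffAt ℝ ∞ (fun z => (g z)⁻¹ i j) y := by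
  simp only [Matrix.inv_def, Ring.inverse_eq_inv', Matrix.smul_apply, smul_eq_mul,
    Matrix.adjugate_apply]
  refine ((contDiffAt_det (hg.smooth y hy)).inv (hg.nondeg y hy).ne_zero).mul ?_
  refine contDiffAt_det fun k l => ?_
  by_cases hk : k = j
  · subst hk; simp only [Matrix.updateRow_self]; exact contDiffAt_const
  · simp only [Matrix.updateRow_ne hk]; exact hg.smooth y hy k l

theorem differentiable_inv (i j : Fin 4) : DifferentiableAt ℝ (fun z => (g z)⁻¹ i j) y :=
  (hg.smooth_inv hy i j).differentiableAt (by simp)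

theorem pderiv_symm (k i j : Fin 4) :
    pderiv k (fun z => g z i j) y = pderiv k (fun z => g z j i) y :=
  hg.pderiv_congr hy fun z hz => hg.symm z hz i j

theorem smooth_pderiv (k i j : Fin 4) : ContDiffAt ℝ ∞ (pderiv k fun z => g z i j) y :=
  contDiffAt_pderiv (hg.smooth y hy i j)

theorem smooth_christoffelFirst (a i j : Fin 4) : ContDiffAt ℝ ∞ (christoffelFirst g a i j) y := by
  have := hg.smooth_pderiv hy
  unfold christoffelFirst
  fun_prop

theorem smooth_christoffel (a i j : Fin 4) : ContDiffAt ℝ ∞ (christoffel g a i j) y := by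
  rw [funext (christoffel_eq g a i j)]
  exact ContDiffAt.sum fun l _ => (hg.smooth_inv hy a l).mul (hg.smooth_christoffelFirst hy l i j)

theorem christoffelFirst_symm (a i j : Fin 4) :
    christoffelFirst g a i j y = christoffelFirst g a j i y := by
  simp only [christoffelFirst]
  rw [hg.pderiv_symm hy i a j, hg.pderiv_symm hy j i a, hg.pderiv_symm hy a i j]; ring

theorem lower_christoffel (a i j : Fin 4) :
    ∑ k, g y a k * christoffel g k i j y = christoffelFirst g a i j y := by
  simp only [christoffel_eq, Finset.mul_sum, ← mul_assoc]
  rw [Finset.sum_comm]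
  simp [← Finset.sum_mul, sum_mul_inv (hg.nondeg y hy)]

/-- This is `∇g = 0` with all indices lowered; it trades first derivatives of the metric for
Christoffel symbols. -/
theorem pderiv_eq_christoffelFirst (e a b : Fin 4) :
    pderiv e (fun z => g z a b) y = christoffelFirst g a e b y + christoffelFirst g b e a y := by
  simp only [christoffelFirst]
  rw [hg.pderiv_symm hy e b a, hg.pderiv_symm hy b e a, hg.pderiv_symm hy a e b]; ring

theorem pderiv_christoffelFirst (c a i j : Fin 4) :
    pderiv c (christoffelFirst g a i j) y = (1 / 2 : ℝ) *
      (pderiv c (pderiv i fun z => g z a j) y + pderiv c (pderiv j fun z => g z i a) y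
        - pderiv c (pderiv a fun z => g z i j) y) := by
  have h : ∀ k i j, DifferentiableAt ℝ (pderiv k fun z => g z i j) y := fun k i j =>
    (hg.smooth_pderiv hy k i j).differentiableAt (by simp)
  unfold christoffelFirst
  rw [pderiv_const_mul (by fun_prop),
    pderiv_sub (by fun_prop) (h _ _ _), pderiv_add (h _ _ _) (h _ _ _)]

theorem lower_pderiv_christoffel (c a i j : Fin 4) :
    ∑ f, g y a f * pderiv c (christoffel g f i j) y = pderiv c (christoffelFirst g a i j) y
      - ∑ f, (christoffelFirst g a c f y + christoffelFirst g f c a y) * christoffel g f i j y := by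
  have h : ∀ k i j, DifferentiableAt ℝ (christoffel g k i j) y := fun k i j =>
    (hg.smooth_christoffel hy k i j).differentiableAt (by simp)
  have e : pderiv c (christoffelFirst g a i j) y =
      pderiv c (fun z => ∑ k, g z a k * christoffel g k i j z) y :=
    hg.pderiv_congr hy fun z hz => (hg.lower_christoffel hz a i j).symm
  rw [e, pderiv_sum fun k _ => by have := hg.differentiable hy a k; have := h k i j; fun_prop]
  simp only [pderiv_mul (hg.differentiable hy _ _) (h _ _ _), hg.pderiv_eq_christoffelFirst hy c a,
    Finset.sum_add_distrib]
  ring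

/-- Lowering the index through the product rule avoids differentiating the inverse metric, and half
of the quadratic terms cancel. What remains is second derivatives of `g` and two pairings of
Christoffel symbols of the first kind, a form from which the symmetries and the conformal change can
be read off. -/
theorem riemann_eq (a b c d : Fin 4) : riemann g y a b c d =
    pderiv c (christoffelFirst g a d b) y - pderiv d (christoffelFirst g a c b) y
      + dot (g y)⁻¹ (fun f => christoffelFirst g f d a y) (fun f => christoffelFirst g f c b y)
      - dot (g y)⁻¹ (fun f => christoffelFirst g f c a y)
        (fun f => christoffelFirst g f d b y) := by
  have hdot : ∀ c a d b, dot (g y)⁻¹ (fun f => christoffelFirst g f c a y)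
      (fun f => christoffelFirst g f d b y) =
      ∑ f, christoffelFirst g f c a y * christoffel g f d b y := by
    intro c a d b
    simp only [dot, christoffel_eq, Finset.mul_sum]
    exact Finset.sum_congr rfl fun _ _ => Finset.sum_congr rfl fun _ _ => by ring
  have hq : ∀ c d, ∑ f, g y a f * ∑ e, christoffel g f c e y * christoffel g e d b y =
      ∑ f, christoffelFirst g a c f y * christoffel g f d b y := by
    intro c d
    simp only [Finset.mul_sum, ← mul_assoc]
    rw [Finset.sum_comm]
    simp only [← Finset.sum_mul, hg.lower_christoffel hy]
  simp only [riemann, riemannUp, mul_add, mul_sub, Finset.sum_add_distrib, Finset.sum_sub_distrib,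
    hq, hg.lower_pderiv_christoffel hy, hdot, add_mul]
  ring

theorem pderiv_pderiv_comm (k l i j : Fin 4) :
    pderiv k (pderiv l fun z => g z i j) y = pderiv l (pderiv k fun z => g z i j) y :=
  pderiv_comm (hg.smooth y hy i j)

theorem pderiv_pderiv_symm (k l i j : Fin 4) :
    pderiv k (pderiv l fun z => g z i j) y = pderiv k (pderiv l fun z => g z j i) y :=
  hg.pderiv_congr hy fun _ hz => hg.pderiv_symm hz l i j

theorem riemann_antisymm_right (a b c d : Fin 4) :
    riemann g y a b d c = -riemann g y a b c d := by
  simp only [hg.riemann_eq hy]; ring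

theorem riemann_antisymm_left (a b c d : Fin 4) :
    riemann g y b a c d = -riemann g y a b c d := by
  simp only [hg.riemann_eq hy, hg.pderiv_christoffelFirst hy]
  have hs := inv_symm (hg.symm y hy)
  rw [dot_comm (fun f => christoffelFirst g f d b y) _ hs,
    dot_comm (fun f => christoffelFirst g f c b y) _ hs,
    hg.pderiv_pderiv_symm hy c d b a, hg.pderiv_pderiv_symm hy d c b a,
    hg.pderiv_pderiv_comm hy c d a b,
    hg.pderiv_pderiv_symm hy c a d b, hg.pderiv_pderiv_symm hy c b d a,
    hg.pderiv_pderiv_symm hy d a c b, hg.pderiv_pderiv_symm hy d b c a]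
  ring

theorem riemann_bianchi (a b c d : Fin 4) :
    riemann g y a b c d + riemann g y a c d b + riemann g y a d b c = 0 := by
  simp only [hg.riemann_eq hy, hg.pderiv_christoffelFirst hy]
  simp only [hg.christoffelFirst_symm hy _ d c, hg.christoffelFirst_symm hy _ d b,
    hg.christoffelFirst_symm hy _ c b]
  rw [hg.pderiv_pderiv_symm hy c b d a, hg.pderiv_pderiv_symm hy d b c a,
    hg.pderiv_pderiv_symm hy c a d b, hg.pderiv_pderiv_symm hy d a c b,
    hg.pderiv_pderiv_symm hy b a d c, hg.pderiv_pderiv_symm hy b d c a,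
    hg.pderiv_pderiv_symm hy b c d a,hg.pderiv_pderiv_symm hy c d b a,
    hg.pderiv_pderiv_symm hy d c b a]
  ring

/-- A formal consequence of the two antisymmetries and the cyclic identity: a signed combination of
the four cyclic sums with first index `a`, `b`, `c`, `d` leaves only the two components to be
compared. -/
theorem riemann_pair_symm (a b c d : Fin 4) :
    riemann g y c d a b = riemann g y a b c d := by
  have l := hg.riemann_antisymm_left hy
  have r := hg.riemann_antisymm_right hy
  have B := hg.riemann_bianchi hy
  linarith [B a b c d, B b c d a, B c d a b, B d a b c, l a b c d, l a c b d, l a d b c, l b c a d,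
    l b d a c, l c d a b, r a b c d, r a c b d, r a d b c, r b c a d, r b d a c, r c d a b,
    l a b d c, l a c d b, l a d c b, l b c d a, l b d c a, l c d b a]

end SmoothMetricOn

/-- The Kulkarni–Nomizu product `g_{ac}B_{bd} - g_{ad}B_{bc} + g_{bd}B_{ac} - g_{bc}B_{ad}`. -/
def kulkarniNomizu {V : Type*} [AddCommGroup V] [Module ℝ V] (g : Matrix (Fin 4) (Fin 4) ℝ)
    (B : Fin 4 → Fin 4 → V) : Tensor4 V :=
  fun a b c d => g a c • B b d - g a d • B b c + g b d • B a c - g b c • B a d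

/-! ### Pointwise algebra: trace removal and the Bianchi projection. -/

section Pointwise

variable {V : Type*} [AddCommGroup V] [Module ℝ V] {g : Matrix (Fin 4) (Fin 4) ℝ}

theorem trace13_add (S T : Tensor4 V) (b d : Fin 4) :
    trace13 g (fun a b c d => S a b c d + T a b c d) b d = trace13 g S b d + trace13 g T b d := by
  simp [trace13, Finset.sum_add_distrib]

theorem scalarTrace_add (S T : Tensor4 V) :
    scalarTrace g (fun a b c d => S a b c d + T a b c d) = scalarTrace g S + scalarTrace g T := by
  simp [scalarTrace, trace13_add, Finset.sum_add_distrib]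

theorem weylPart_add (S T : Tensor4 V) :
    weylPart g (fun a b c d => S a b c d + T a b c d) =
      fun a b c d => weylPart g S a b c d + weylPart g T a b c d := by
  funext a b c d
  simp only [weylPart, trace13_add, scalarTrace_add]
  module

theorem inv_smul_of_isUnit (hg : IsUnit g.det) {r : ℝ} (hr : r ≠ 0) : (r • g)⁻¹ = r⁻¹ • g⁻¹ := by
  have : Invertible r := invertibleOfNonzero hr
  rw [Matrix.inv_smul _ _ hg, invOf_eq_inv]

theorem trace13_smul (hg : IsUnit g.det) {r : ℝ} (hr : r ≠ 0) (T : Tensor4 V) (b d : Fin 4) :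
    trace13 (r • g) (fun a b c d => r • T a b c d) b d = trace13 g T b d := by
  simp only [trace13, inv_smul_of_isUnit hg hr, Matrix.smul_apply, smul_smul, smul_eq_mul]
  exact Finset.sum_congr rfl fun a _ => Finset.sum_congr rfl fun c _ => by
    congr 1; field_simp

theorem weylPart_smul (hg : IsUnit g.det) {r : ℝ} (hr : r ≠ 0) (T : Tensor4 V) :
    weylPart (r • g) (fun a b c d => r • T a b c d) = fun a b c d => r • weylPart g T a b c d := by
  funext a b c d
  have hs : scalarTrace (r • g) (fun a b c d => r • T a b c d) = r⁻¹ • scalarTrace g T := by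
    simp only [scalarTrace, trace13_smul hg hr, inv_smul_of_isUnit hg hr, Matrix.smul_apply,
      smul_eq_mul, Finset.smul_sum, smul_smul]
  simp only [weylPart, trace13_smul hg hr, hs, Matrix.smul_apply, smul_eq_mul, smul_smul, smul_sub,
    smul_add]
  congr 1
  · module
  · congr 1; field_simp

theorem sum_inv_smul_left (hg : IsUnit g.det) (hs : ∀ i j, g i j = g j i) (b : Fin 4)
    (v : Fin 4 → V) : ∑ a, ∑ c, (g⁻¹ a c * g a b) • v c = v b := by
  rw [Finset.sum_comm]
  have : ∀ c, ∑ a, g⁻¹ a c * g a b = if b = c then 1 else 0 := fun c => by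
    rw [← sum_mul_inv hg b c]
    exact Finset.sum_congr rfl fun a _ => by rw [hs a b]; ring
  simp only [← Finset.sum_smul, this, ite_smul, one_smul, zero_smul]
  simp

theorem sum_inv_smul_right (hg : IsUnit g.det) (b : Fin 4)
    (v : Fin 4 → V) : ∑ a, ∑ c, (g⁻¹ a c * g c b) • v a = v b := by
  simp only [← Finset.sum_smul, sum_inv_mul hg, ite_smul, one_smul, zero_smul]
  simp

theorem sum_inv_mul_self (hg : IsUnit g.det) (hs : ∀ i j, g i j = g j i) :
    ∑ a, ∑ c, g⁻¹ a c * g a c = 4 := by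
  have : ∀ a, ∑ c, g⁻¹ a c * g a c = 1 := fun a => by
    simp only [hs a]; rw [sum_inv_mul hg]; simp
  simp [this]

theorem trace13_kulkarniNomizu (hg : IsUnit g.det) (hs : ∀ i j, g i j = g j i)
    (B : Fin 4 → Fin 4 → V) (b d : Fin 4) :
    trace13 g (kulkarniNomizu g B) b d =
      (2 : ℝ) • B b d + g b d • ∑ a, ∑ c, g⁻¹ a c • B a c := by
  have h1 : ∑ a, ∑ c, (g⁻¹ a c * g a c) • B b d = (4 : ℝ) • B b d := by
    simp only [← Finset.sum_smul, sum_inv_mul_self hg hs]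
  have h2 := sum_inv_smul_left hg hs d (fun c => B b c)
  have h3 := sum_inv_smul_right hg b (fun a => B a d)
  have h4 : ∑ a, ∑ c, g⁻¹ a c • g b d • B a c = g b d • ∑ a, ∑ c, g⁻¹ a c • B a c := by
    simp only [Finset.smul_sum, smul_comm (g b d)]
  simp only [trace13, kulkarniNomizu, smul_sub, smul_add, Finset.sum_sub_distrib,
    Finset.sum_add_distrib, h4]
  simp only [smul_smul, h1, h2, hs b, h3]
  module

/-- With `t` the trace of `B`, the product has trace `2B + t g` and scalar trace `6t`. Inserted with
the coefficients `1/2` and `1/6` of dimension four, these reproduce the product itself, which is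
thereby subtracted completely. -/
theorem weylPart_kulkarniNomizu (hg : IsUnit g.det) (hs : ∀ i j, g i j = g j i)
    (B : Fin 4 → Fin 4 → V) :
    weylPart g (kulkarniNomizu g B) = 0 := by
  have h : scalarTrace g (kulkarniNomizu g B) = (6 : ℝ) • ∑ a, ∑ c, g⁻¹ a c • B a c := by
    set t := ∑ a, ∑ c, g⁻¹ a c • B a c with ht
    have h1 : ∑ b, ∑ d, g⁻¹ b d • (2 : ℝ) • B b d = (2 : ℝ) • t := by
      simp only [ht, Finset.smul_sum, smul_comm (2 : ℝ)]
    have h2 : ∑ b, ∑ d, (g⁻¹ b d * g b d) • t = (4 : ℝ) • t := by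
      simp only [← Finset.sum_smul, sum_inv_mul_self hg hs]
    simp only [scalarTrace, trace13_kulkarniNomizu hg hs, ← ht, smul_add, Finset.sum_add_distrib,
      h1]
    simp only [smul_smul, h2]
    module
  funext a b c d
  simp only [weylPart, trace13_kulkarniNomizu hg hs, h, Pi.zero_apply]
  simp only [kulkarniNomizu]
  module

/-- The algebraic symmetries of a curvature tensor, apart from the Bianchi identity. -/
structure IsRiemannLike (T : Tensor4 V) : Prop where
  antisymm_left : ∀ a b c d, T b a c d = -T a b c d
  antisymm_right : ∀ a b c d, T a b d c = -T a b c d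
  pair_symm : ∀ a b c d, T c d a b = T a b c d

theorem IsRiemannLike.trace13_symm {T : Tensor4 V} (hT : IsRiemannLike T)
    (hs : ∀ i j, g i j = g j i) (b d : Fin 4) : trace13 g T b d = trace13 g T d b := by
  unfold trace13
  rw [Finset.sum_comm]
  exact Finset.sum_congr rfl fun a _ => Finset.sum_congr rfl fun c _ => by
    rw [inv_symm hs c a, hT.pair_symm]

theorem weylPart_isWeylLike (hg : IsUnit g.det) (hs : ∀ i j, g i j = g j i) {T : Tensor4 V}
    (hT : IsRiemannLike T) (hB : ∀ a b c d, antisymBCD T a b c d = 0) :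
    IsWeylLike g (weylPart g T) where
  antisymm_left a b c d := by
    simp only [weylPart]
    rw [hT.antisymm_left a b c d]
    module
  antisymm_right a b c d := by
    simp only [weylPart]
    rw [hT.antisymm_right a b c d]
    module
  pair_symm a b c d := by
    simp only [weylPart]
    rw [hT.pair_symm a b c d, hT.trace13_symm hs d b, hT.trace13_symm hs d a,
      hT.trace13_symm hs c a, hT.trace13_symm hs c b, hs c a, hs c b, hs d b, hs d a]
    module
  bianchi a b c d := by
    have h := hB a b c d
    simp only [antisymBCD] at h
    simp only [antisymBCD, weylPart]
    rw [hT.trace13_symm hs d b, hT.trace13_symm hs d c, hT.trace13_symm hs c b,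
      hs d b, hs d c, hs c b]
    refine Eq.trans ?_ h
    module
  traceFree b d := by
    -- The whole trace correction is one Kulkarni–Nomizu product. The coefficient is `1/12` rather
    -- than `1/6` because the product of `g` with itself counts `g_{ac} g_{bd} - g_{ad} g_{bc}`
    -- twice.
    have hw : weylPart g T = fun a b c d => T a b c d + kulkarniNomizu g (fun b d =>
        -(1 / 2 : ℝ) • trace13 g T b d + ((1 / 12 : ℝ) * g b d) • scalarTrace g T) a b c d := by
      funext a b c d
      simp only [weylPart, kulkarniNomizu]
      module
    have h1 : ∑ a, ∑ c, g⁻¹ a c • (-(1 / 2 : ℝ)) • trace13 g T a c =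
        (-(1 / 2 : ℝ)) • scalarTrace g T := by
      simp only [scalarTrace, Finset.smul_sum, smul_comm (-(1 / 2 : ℝ))]
    have h2 : ∑ a, ∑ c, g⁻¹ a c • ((1 / 12 : ℝ) * g a c) • scalarTrace g T =
        (1 / 3 : ℝ) • scalarTrace g T := by
      have : ∀ a c, g⁻¹ a c • ((1 / 12 : ℝ) * g a c) • scalarTrace g T =
          (g⁻¹ a c * g a c) • (1 / 12 : ℝ) • scalarTrace g T := fun a c => by module
      simp only [this, ← Finset.sum_smul, sum_inv_mul_self hg hs]
      module
    rw [hw, trace13_add, trace13_kulkarniNomizu hg hs]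
    simp only [smul_add, Finset.sum_add_distrib, h1, h2]
    module

/-- Antisymmetrisation is a projection, so subtracting it enforces the algebraic Bianchi identity.
-/
theorem antisymBCD_antisymBCD (T : Tensor4 V) : antisymBCD (antisymBCD T) = antisymBCD T := by
  funext a b c d
  simp only [antisymBCD]
  module

theorem antisymBCD_sub (S T : Tensor4 V) :
    antisymBCD (fun a b c d => S a b c d - T a b c d) =
      fun a b c d => antisymBCD S a b c d - antisymBCD T a b c d := by
  funext a b c d
  simp only [antisymBCD]
  module

/-- Given the antisymmetry in the last pair, the antisymmetrisation is a third of the cyclic sum,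
and the symmetries permute the three terms of that sum up to sign. -/
theorem IsRiemannLike.antisymBCD {T : Tensor4 V} (hT : IsRiemannLike T) :
    IsRiemannLike (antisymBCD T) := by
  have l := hT.antisymm_left
  have r := hT.antisymm_right
  have p := hT.pair_symm
  have key : ConformalInvariants.antisymBCD T = fun a b c d => (1 / 3 : ℝ) •
      (T a b c d + T a c d b + T a d b c) := by
    funext a b c d
    simp only [ConformalInvariants.antisymBCD]
    rw [r a b c d, r a d b c, r a c d b]; module
  rw [key]
  refine ⟨fun a b c d => ?_, fun a b c d => ?_, fun a b c d => ?_⟩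
  · rw [l a b c d, p d a b c, l a d b c, p a c b d, r a c d b]; module
  · rw [r a b c d, r a d b c, r a c d b]; module
  · rw [p a b c d, l a c b d, r a c d b, p d a c b, l a d c b, r a d b c]; module

end Pointwise

/-- Two metrics on an open set related by `g' = e^{2u} g`. -/
structure ConformalOn (O : Set E4) (g g' : E4 → Matrix (Fin 4) (Fin 4) ℝ) (u : E4 → ℝ) : Prop where
  base : SmoothMetricOn O g
  smooth : ∀ y ∈ O, ContDiffAt ℝ ∞ u y
  eq_smul : ∀ y ∈ O, g' y = Real.exp (2 * u y) • g y

/-- A nonnegative factor does not move the argument across the branch cut, so it leaves the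
principal root even when `x` is negative. -/
theorem sqrt_ofReal_sq_mul {r : ℝ} (hr : 0 ≤ r) (x : ℝ) :
    Complex.sqrt ((r ^ 2 * x : ℝ) : ℂ) = (r : ℂ) * Complex.sqrt (x : ℂ) := by
  have h : ∀ t, √((r ^ 2 * t) / 2) = r * √(t / 2) := fun t => by
    rw [mul_div_assoc, Real.sqrt_mul (sq_nonneg r), Real.sqrt_sq hr]
  simp only [Complex.sqrt_eq_real_add_ite, Complex.ofReal_im, Complex.ofReal_re, le_refl, if_true,
    Complex.norm_real, Real.norm_eq_abs, abs_mul, abs_of_nonneg (sq_nonneg r), ← mul_add, ← mul_sub,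
    h]
  push_cast
  ring

open scoped ComplexOrder in
-- The sign of the real function `f` is constant near `y`. Where `f` is negative it runs along the
-- branch cut without crossing it, and there the root is `i √(-f)`.
theorem contDiffAt_sqrt_ofReal {f : E4 → ℝ} {y : E4} (hf : ContDiffAt ℝ ∞ f y) (h0 : f y ≠ 0) :
    ContDiffAt ℝ ∞ (fun z => Complex.sqrt (f z : ℂ)) y := by
  rcases h0.lt_or_gt with h | h
  · have e : (fun z => Complex.sqrt (f z : ℂ)) =ᶠ[𝓝 y] fun z => Complex.I * (√(-f z) : ℝ) := by
      filter_upwards [hf.continuousAt.eventually_lt continuousAt_const h] with z hz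
      have hz' : (0 : ℂ) ≤ ((-f z : ℝ) : ℂ) := Complex.zero_le_real.2 (by linarith)
      have := Complex.sqrt_neg_of_nonneg hz'
      rwa [Complex.sqrt_of_nonneg hz', Complex.ofReal_re, ← Complex.ofReal_neg, neg_neg] at this
    have h1 := contDiffAt_ofReal (hf.neg.sqrt (by simpa using h0))
    exact (contDiffAt_const.mul h1).congr_of_eventuallyEq e
  · have e : (fun z => Complex.sqrt (f z : ℂ)) =ᶠ[𝓝 y] fun z => ((√(f z) : ℝ) : ℂ) := by
      filter_upwards [continuousAt_const.eventually_lt hf.continuousAt h] with z hz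
      rw [Complex.sqrt_of_nonneg (Complex.zero_le_real.2 hz.le), Complex.ofReal_re]
    exact (contDiffAt_ofReal (hf.sqrt h0)).congr_of_eventuallyEq e

/-! ### Conformal change of the curvature and of `W`. -/

namespace ConformalOn

variable {O : Set E4} {g g' : E4 → Matrix (Fin 4) (Fin 4) ℝ} {u : E4 → ℝ}
  (H : ConformalOn O g g' u)
include H

theorem target : SmoothMetricOn O g' where
  isOpen := H.base.isOpen
  smooth y hy i j := by
    have e : (fun z => Real.exp (2 * u z) * g z i j) =ᶠ[𝓝 y] fun z => g' z i j :=
      H.base.eventually hy fun z hz => by simp [H.eq_smul z hz]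
    have h1 := H.base.smooth y hy i j
    have h2 := H.smooth y hy
    exact ContDiffAt.congr_of_eventuallyEq (by fun_prop) e.symm
  symm y hy i j := by simp [H.eq_smul y hy, H.base.symm y hy i j]
  nondeg y hy := by
    rw [H.eq_smul y hy, Matrix.det_smul]
    exact ((isUnit_iff_ne_zero.2 (Real.exp_pos _).ne').pow _).mul (H.base.nondeg y hy)

variable {y : E4} (hy : y ∈ O)
include hy

theorem differentiable : DifferentiableAt ℝ u y := (H.smooth y hy).differentiableAt (by simp)

theorem inv_eq : (g' y)⁻¹ = (Real.exp (2 * u y))⁻¹ • (g y)⁻¹ := by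
  rw [H.eq_smul y hy, inv_smul_of_isUnit (H.base.nondeg y hy) (Real.exp_pos _).ne']

theorem pderiv_eq (k i j : Fin 4) : pderiv k (fun z => g' z i j) y =
    Real.exp (2 * u y) * (pderiv k (fun z => g z i j) y + 2 * pderiv k u y * g y i j) := by
  have h1 := H.base.differentiable hy i j
  have h2 := H.differentiable hy
  have e : pderiv k (fun z => g' z i j) y = pderiv k (fun z => Real.exp (2 * u z) * g z i j) y :=
    H.base.pderiv_congr hy fun z hz => by simp [H.eq_smul z hz]
  rw [e, pderiv_mul (by fun_prop) h1, pderiv_exp_two_mul h2]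
  ring

theorem pderiv_pderiv_eq (l k i j : Fin 4) : pderiv l (pderiv k fun z => g' z i j) y =
    Real.exp (2 * u y) * (pderiv l (pderiv k fun z => g z i j) y
      + 2 * pderiv l u y * pderiv k (fun z => g z i j) y
      + 2 * pderiv k u y * pderiv l (fun z => g z i j) y
      + (2 * pderiv l (pderiv k u) y + 4 * pderiv l u y * pderiv k u y) * g y i j) := by
  have h1 := H.base.differentiable hy i j
  have h2 := H.differentiable hy
  have h3 : DifferentiableAt ℝ (pderiv k fun z => g z i j) y :=
    (H.base.smooth_pderiv hy k i j).differentiableAt (by simp)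
  have h4 : DifferentiableAt ℝ (pderiv k u) y :=
    (contDiffAt_pderiv (H.smooth y hy)).differentiableAt (by simp)
  rw [H.base.pderiv_congr hy fun z hz => H.pderiv_eq hz k i j, pderiv_mul (by fun_prop)
    (by fun_prop), pderiv_exp_two_mul h2, ConformalInvariants.pderiv_add h3 (by fun_prop),
    pderiv_mul (by fun_prop) h1, pderiv_const_mul h4]
  ring

theorem christoffelFirst_eq (a i j : Fin 4) : christoffelFirst g' a i j y =
    Real.exp (2 * u y) * (christoffelFirst g a i j y + pderiv i u y * g y a j
      + pderiv j u y * g y a i - pderiv a u y * g y i j) := by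
  simp only [christoffelFirst, H.pderiv_eq hy, H.base.symm y hy i a]
  ring

theorem christoffel_eq (k i j : Fin 4) : christoffel g' k i j y = christoffel g k i j y
    + pderiv i u y * (if k = j then 1 else 0) + pderiv j u y * (if k = i then 1 else 0)
    - g y i j * ∑ l, (g y)⁻¹ k l * pderiv l u y := by
  simp only [ConformalInvariants.christoffel_eq, H.inv_eq hy, H.christoffelFirst_eq hy,
    ← sum_inv_mul (H.base.nondeg y hy), Finset.mul_sum]
  rw [← Finset.sum_add_distrib, ← Finset.sum_add_distrib, ← Finset.sum_sub_distrib]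
  refine Finset.sum_congr rfl fun l _ => ?_
  have := (Real.exp_pos (2 * u y)).ne'
  simp only [Matrix.smul_apply, smul_eq_mul]
  field_simp

/-- The Riemann tensor changes by a Kulkarni–Nomizu product with the metric. -/
theorem riemann_eq : ∃ B : Fin 4 → Fin 4 → ℝ, riemann g' y = fun a b c d =>
    Real.exp (2 * u y) • (riemann g y a b c d + kulkarniNomizu (g y) B a b c d) := by
  have hG := H.base
  have hs := inv_symm (hG.symm y hy)
  set v : Fin 4 → ℝ := fun i => pderiv i u y with hv
  -- The classical tensor `-∇_i∇_j u + ∂_i u ∂_j u - ½ |du|² g_{ij}`; the pairing with the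
  -- Christoffel symbols completes the second partial derivative to the covariant Hessian.
  refine ⟨fun i j => -pderiv i (pderiv j u) y +
    dot (g y)⁻¹ v (fun f => christoffelFirst g f i j y) + v i * v j
    - (1 / 2 : ℝ) * dot (g y)⁻¹ v v * g y i j, ?_⟩
  funext a b c d
  have hΓ : ∀ i j, (fun f => christoffelFirst g' f i j y) = Real.exp (2 * u y) •
      ((fun f => christoffelFirst g f i j y) + v i • g y j + v j • g y i - g y i j • v) := by
    intro i j
    funext f
    simp only [H.christoffelFirst_eq hy, Pi.smul_apply, Pi.add_apply, Pi.sub_apply, smul_eq_mul,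
      hG.symm y hy f, hv]
    ring
  have dr : ∀ β a, dot (g y)⁻¹ β (g y a) = β a := fun β a => by
    rw [dot_comm _ _ hs, dot_inv_left _ (hG.nondeg y hy)]
  rw [H.target.riemann_eq hy, hG.riemann_eq hy]
  simp only [H.target.pderiv_christoffelFirst hy, hG.pderiv_christoffelFirst hy, hΓ, H.inv_eq hy,
    dot_smul_matrix, dot_smul_left, dot_smul_right, dot_add_left, dot_add_right, dot_sub_left,
    dot_sub_right, dot_inv_left _ (hG.nondeg y hy), dr, H.pderiv_pderiv_eq hy, kulkarniNomizu,
    smul_eq_mul, dot_comm v (fun f => christoffelFirst g f _ _ y) hs]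
  have hE := (Real.exp_pos (2 * u y)).ne'
  have hΓs := hG.christoffelFirst_symm hy
  have hu : ∀ i j, pderiv i (pderiv j u) y = pderiv j (pderiv i u) y := fun i j =>
    pderiv_comm (H.smooth y hy)
  have hq := hG.pderiv_pderiv_symm hy
  have hc := hG.pderiv_pderiv_comm hy
  have hgs := hG.symm y hy
  -- First derivatives of the metric become Christoffel symbols, and all symmetric index pairs are
  -- put in a fixed order; the claim is then a polynomial identity.
  simp only [hG.pderiv_eq_christoffelFirst hy]
  simp only [hΓs _ b a, hΓs _ c a, hΓs _ d a, hΓs _ c b, hΓs _ d b, hΓs _ d c, hgs b a, hgs c a,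
    hgs d a, hgs c b, hgs d b, hgs d c, hu c a, hu d a, hu c b, hu d b, hu d c,
    hq _ _ c a, hq _ _ d a, hq _ _ c b, hq _ _ d b,
    hc c a, hc d a, hc c b, hc d b, hc d c, hv]
  field_simp
  ring

/-- Conformal covariance of the Weyl tensor. -/
theorem weyl_eq : weyl g' y = fun a b c d => Real.exp (2 * u y) * weyl g y a b c d := by
  obtain ⟨B, hB⟩ := H.riemann_eq hy
  have hG := H.base
  rw [weyl, hB, H.eq_smul y hy, weylPart_smul (hG.nondeg y hy) (Real.exp_pos _).ne', weylPart_add,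
    weylPart_kulkarniNomizu (hG.nondeg y hy) (hG.symm y hy)]
  simp [weyl]

/-- Two Weyl tensors of weight `e^{2u}` against two inverse metrics of weight `e^{-2u}`. -/
theorem weylProduct_eq : weylProduct g' y = weylProduct g y := by
  have hE := (Real.exp_pos (2 * u y)).ne'
  funext a b c d
  simp only [weylProduct, H.weyl_eq hy, H.inv_eq hy, Matrix.smul_apply, smul_eq_mul]
  refine Finset.sum_congr rfl fun e _ => Finset.sum_congr rfl fun f _ =>
    Finset.sum_congr rfl fun p _ => Finset.sum_congr rfl fun q _ => ?_
  field_simp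

/-- Four inverse metrics and two Weyl tensors give weight `e^{-4u}`, written as a square so that its
positive root leaves the complex square root. -/
theorem I1_eq : I1 g' y = (Real.exp (2 * u y))⁻¹ ^ 2 * I1 g y := by
  have hE := (Real.exp_pos (2 * u y)).ne'
  simp only [I1, H.weyl_eq hy, H.inv_eq hy, Matrix.smul_apply, smul_eq_mul, Finset.mul_sum]
  refine Finset.sum_congr rfl fun a _ => Finset.sum_congr rfl fun b _ =>
    Finset.sum_congr rfl fun c _ => Finset.sum_congr rfl fun d _ =>
    Finset.sum_congr rfl fun p _ => Finset.sum_congr rfl fun q _ =>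
    Finset.sum_congr rfl fun r _ => Finset.sum_congr rfl fun s _ => ?_
  field_simp

/-- The weight `e^{2u}` comes from `√I₁` in the denominator. Where `I₁` vanishes both sides are
zero, division by zero being zero; so the law holds throughout `O` and can be differentiated. -/
theorem weylSq_eq : weylSq g' y = fun a b c d =>
    Real.exp (2 * u y) • weylSq g y a b c d := by
  have hE := Real.exp_pos (2 * u y)
  have hs : Complex.sqrt (I1 g' y : ℂ) =
      ((Real.exp (2 * u y))⁻¹ : ℝ) * Complex.sqrt (I1 g y : ℂ) := by
    rw [H.I1_eq hy, sqrt_ofReal_sq_mul (inv_nonneg.2 hE.le)]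
  funext a b c d
  simp only [weylSq, H.weylProduct_eq hy, hs, Complex.real_smul]
  push_cast
  field_simp

theorem W_eq : W g' y = fun a b c d => Real.exp (2 * u y) • W g y a b c d := by
  have h : (fun a b c d => weylSq g' y a b c d - antisymBCD (weylSq g' y) a b c d) =
      fun a b c d => Real.exp (2 * u y) •
        (weylSq g y a b c d - antisymBCD (weylSq g y) a b c d) := by
    funext a b c d
    simp only [H.weylSq_eq hy, antisymBCD]
    module
  rw [W, h, H.eq_smul y hy, weylPart_smul (H.base.nondeg y hy) (Real.exp_pos _).ne']
  rfl

end ConformalOn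

/-! ### Weyl symmetries and smoothness of `W`. -/

namespace SmoothMetricOn
variable {O : Set E4} {g : E4 → Matrix (Fin 4) (Fin 4) ℝ} (hg : SmoothMetricOn O g) {y : E4}
  (hy : y ∈ O)
include hg hy

theorem riemann_isRiemannLike : IsRiemannLike (riemann g y) :=
  ⟨hg.riemann_antisymm_left hy, hg.riemann_antisymm_right hy, hg.riemann_pair_symm hy⟩

theorem weyl_isWeylLike : IsWeylLike (g y) (weyl g y) := by
  refine weylPart_isWeylLike (hg.nondeg y hy) (hg.symm y hy) (hg.riemann_isRiemannLike hy)
    fun a b c d => ?_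
  have h1 := hg.riemann_bianchi hy a b c d
  have r := hg.riemann_antisymm_right hy
  simp only [antisymBCD, smul_eq_mul]
  rw [r a b c d, r a c d b, r a d b c]
  linear_combination (1 / 3 : ℝ) * h1

/-- As a form on bivectors `C` is symmetric, and the product is its square with respect to the
metric, again symmetric. -/
theorem weylProduct_isRiemannLike : IsRiemannLike (weylProduct g y) := by
  have hC := hg.weyl_isWeylLike hy
  refine ⟨fun a b c d => ?_, fun a b c d => ?_, fun a b c d => ?_⟩
  · simp only [weylProduct, hC.antisymm_left a b, mul_neg, neg_mul, Finset.sum_neg_distrib]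
  · simp only [weylProduct, hC.antisymm_right _ _ c d, mul_neg, Finset.sum_neg_distrib]
  · simp only [weylProduct]
    have hi := inv_symm (hg.symm y hy)
    calc _ = ∑ e, ∑ f, ∑ p, ∑ q, (g y)⁻¹ p e * (g y)⁻¹ q f * weyl g y a b e f *
          weyl g y p q c d := by
            refine Finset.sum_congr rfl fun e _ => Finset.sum_congr rfl fun f _ =>
              Finset.sum_congr rfl fun p _ => Finset.sum_congr rfl fun q _ => ?_
            rw [hC.pair_symm p q c d, hC.pair_symm a b e f, hi p e, hi q f]; ring
      _ = ∑ p, ∑ q, ∑ e, ∑ f, (g y)⁻¹ p e * (g y)⁻¹ q f * weyl g y a b e f *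
          weyl g y p q c d := by
            rw [Finset.sum_congr rfl fun e _ => Finset.sum_comm, Finset.sum_comm]
            refine Finset.sum_congr rfl fun p _ => ?_
            rw [Finset.sum_congr rfl fun e _ => Finset.sum_comm, Finset.sum_comm]

theorem W_isWeylLike : IsWeylLike (g y) (W g y) := by
  have hP := hg.weylProduct_isRiemannLike hy
  have hS : IsRiemannLike (weylSq g y) := by
    refine ⟨fun a b c d => ?_, fun a b c d => ?_, fun a b c d => ?_⟩ <;> simp only [weylSq]
    · rw [hP.antisymm_left]; push_cast; ring
    · rw [hP.antisymm_right]; push_cast; ring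
    · rw [hP.pair_symm]
  have hA := hS.antisymBCD
  refine weylPart_isWeylLike (hg.nondeg y hy) (hg.symm y hy)
    ⟨fun a b c d => ?_, fun a b c d => ?_, fun a b c d => ?_⟩ fun a b c d => ?_
  · rw [hS.antisymm_left, hA.antisymm_left]; ring
  · rw [hS.antisymm_right, hA.antisymm_right]; ring
  · rw [hS.pair_symm, hA.pair_symm]
  · rw [antisymBCD_sub]
    beta_reduce
    rw [antisymBCD_antisymBCD, sub_self]

theorem smooth_riemann (a b c d : Fin 4) : ContDiffAt ℝ ∞ (fun z => riemann g z a b c d) y := by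
  have h1 := hg.smooth_christoffel hy
  have h2 := fun i a b c => contDiffAt_pderiv (i := i) (h1 a b c)
  simp only [riemann, riemannUp]
  exact ContDiffAt.sum fun f _ => (hg.smooth y hy a f).mul
    (((h2 _ _ _ _).sub (h2 _ _ _ _)).add (ContDiffAt.sum fun e _ =>
      ((h1 _ _ _).mul (h1 _ _ _)).sub ((h1 _ _ _).mul (h1 _ _ _))))

theorem smooth_weylPart {V : Type*} [NormedAddCommGroup V] [NormedSpace ℝ V] {T : E4 → Tensor4 V}
    (hT : ∀ a b c d, ContDiffAt ℝ ∞ (fun z => T z a b c d) y) (a b c d : Fin 4) :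
    ContDiffAt ℝ ∞ (fun z => weylPart (g z) (T z) a b c d) y := by
  have h1 := hg.smooth y hy
  have h2 := hg.smooth_inv hy
  have h3 : ∀ b d, ContDiffAt ℝ ∞ (fun z => trace13 (g z) (T z) b d) y := fun b d =>
    ContDiffAt.sum fun a _ => ContDiffAt.sum fun c _ => (h2 a c).smul (hT a b c d)
  have h4 : ContDiffAt ℝ ∞ (fun z => scalarTrace (g z) (T z)) y :=
    ContDiffAt.sum fun b _ => ContDiffAt.sum fun d _ => (h2 b d).smul (h3 b d)
  simp only [weylPart]
  fun_prop

theorem smooth_weyl (a b c d : Fin 4) : ContDiffAt ℝ ∞ (fun z => weyl g z a b c d) y :=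
  hg.smooth_weylPart hy (hg.smooth_riemann hy) a b c d

theorem smooth_weylProduct (a b c d : Fin 4) :
    ContDiffAt ℝ ∞ (fun z => weylProduct g z a b c d) y := by
  have h1 := hg.smooth_weyl hy
  have h2 := hg.smooth_inv hy
  simp only [weylProduct]
  iterate 4 refine ContDiffAt.sum fun _ _ => ?_
  exact (((h2 _ _).mul (h2 _ _)).mul (h1 _ _ _ _)).mul (h1 _ _ _ _)

theorem smooth_I1 : ContDiffAt ℝ ∞ (I1 g) y := by
  have h1 := hg.smooth_weyl hy
  have h2 := hg.smooth_inv hy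
  change ContDiffAt ℝ ∞ (fun z => I1 g z) y
  simp only [I1]
  iterate 8 refine ContDiffAt.sum fun _ _ => ?_
  exact (((((h2 _ _).mul (h2 _ _)).mul (h2 _ _)).mul (h2 _ _)).mul (h1 _ _ _ _)).mul (h1 _ _ _ _)

theorem smooth_W (hI : I1 g y ≠ 0) (a b c d : Fin 4) :
    ContDiffAt ℝ ∞ (fun z => W g z a b c d) y := by
  have hP := fun a b c d => contDiffAt_ofReal (hg.smooth_weylProduct hy a b c d)
  have hR : ContDiffAt ℝ ∞ (fun z => 1 / Complex.sqrt (I1 g z : ℂ)) y := by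
    have h0 : Complex.sqrt (I1 g y : ℂ) ≠ 0 := by
      simpa [Complex.sqrt, Complex.cpow_eq_zero_iff] using hI
    simp only [one_div]
    exact (contDiffAt_sqrt_ofReal (hg.smooth_I1 hy) hI).inv h0
  refine hg.smooth_weylPart hy (fun a b c d => ?_) a b c d
  simp only [weylSq, antisymBCD]
  fun_prop

end SmoothMetricOn

/-- Weyl-like tensors for the Euclidean metric on `ℂ⁴`. -/
structure IsEuclideanWeyl (T : Tensor4 ℂ) : Prop where
  antisymm_left : ∀ a b c d, T b a c d = -T a b c d
  antisymm_right : ∀ a b c d, T a b d c = -T a b c d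
  pair_symm : ∀ a b c d, T c d a b = T a b c d
  bianchi : ∀ a b c d, T a b c d + T a c d b + T a d b c = 0
  trace : ∀ b d, ∑ a, T a b a d = 0

/-! ### The quadratic identity for Weyl-like tensors in dimension four. -/

namespace IsEuclideanWeyl

theorem add {A B : Tensor4 ℂ} (hA : IsEuclideanWeyl A) (hB : IsEuclideanWeyl B) :
    IsEuclideanWeyl (fun a b c d => A a b c d + B a b c d) where
  antisymm_left a b c d := by rw [hA.antisymm_left, hB.antisymm_left]; ring
  antisymm_right a b c d := by rw [hA.antisymm_right, hB.antisymm_right]; ring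
  pair_symm a b c d := by rw [hA.pair_symm, hB.pair_symm]
  bianchi a b c d := by linear_combination hA.bianchi a b c d + hB.bianchi a b c d
  trace b d := by rw [Finset.sum_add_distrib, hA.trace, hB.trace, add_zero]

variable {T : Tensor4 ℂ} (hT : IsEuclideanWeyl T)
include hT

theorem left_self (a c d : Fin 4) : T a a c d = 0 := by
  have := hT.antisymm_left a a c d
  linear_combination (1 / 2 : ℂ) * this

theorem right_self (a b c : Fin 4) : T a b c c = 0 := by
  have := hT.antisymm_right a b c c
  linear_combination (1 / 2 : ℂ) * this

/-- In dimension four, `T_{abcd} T_{ebcd}` is a multiple of the metric. -/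
theorem sum_mul_self_eq (a e : Fin 4) : ∑ b, ∑ c, ∑ d, T a b c d * T e b c d =
    if a = e then ∑ b, ∑ c, ∑ d, T 0 b c d * T 0 b c d else 0 := by
  have z := hT.left_self
  have z' := hT.right_self
  have l := hT.antisymm_left
  have r := hT.antisymm_right
  have p := hT.pair_symm
  have tr : ∀ b d, T 0 b 0 d + T 1 b 1 d + T 2 b 2 d + T 3 b 3 d = 0 := fun b d => by
    simpa [Fin.sum_univ_four] using hT.trace b d
  have t00 := tr 0 0
  have t11 := tr 1 1
  have t22 := tr 2 2
  have t33 := tr 3 3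
  have t01 := tr 0 1
  have t02 := tr 0 2
  have t03 := tr 0 3
  have t12 := tr 1 2
  have t13 := tr 1 3
  have t23 := tr 2 3
  have B := hT.bianchi 0 1 2 3
  simp only [z, z', l 0 1, l 0 2, l 0 3, l 1 2, l 1 3, l 2 3, r _ _ 0 1, r _ _ 0 2, r _ _ 0 3,
    r _ _ 1 2, r _ _ 1 3, r _ _ 2 3, neg_neg, zero_add, add_zero]
    at t00 t11 t22 t33 t01 t02 t03 t12 t13 t23 B
  -- The trace and Bianchi equations leave ten independent components. The relations `e1` to `e11`
  -- express the other eleven through them, and the identity becomes sixteen polynomial identities,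
  -- one for each `(a, e)`.
  have e1 : T 2 3 2 3 = T 0 1 0 1 := by linear_combination (1/2:ℂ) * (t22 + t33 - t00 - t11)
  have e2 : T 1 3 1 3 = T 0 2 0 2 := by linear_combination (1/2:ℂ) * (t11 + t33 - t00 - t22)
  have e3 : T 1 2 1 2 = -T 0 1 0 1 - T 0 2 0 2 := by
    linear_combination (1/2:ℂ) * (t11 + t22 + t00 - t33)
  have e4 : T 0 3 0 3 = -T 0 1 0 1 - T 0 2 0 2 := by linear_combination t00
  have e5 : T 0 3 1 2 = T 0 2 1 3 - T 0 1 2 3 := by linear_combination B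
  have e6 : T 0 3 1 3 = - T 0 2 1 2 := by linear_combination t01
  have e7 : T 0 3 2 3 = T 0 1 1 2 := by linear_combination t02
  have e8 : T 0 2 2 3 = -T 0 1 1 3 := by linear_combination -t03
  have e9 : T 1 3 2 3 = -T 0 1 0 2 := by linear_combination t12
  have e10 : T 1 2 2 3 = T 0 1 0 3 := by linear_combination -t13
  have e11 : T 1 2 1 3 = -T 0 2 0 3 := by linear_combination t23
  fin_cases a <;> fin_cases e <;>
  simp [Fin.sum_univ_four, z, z', l 0 1, l 0 2, l 0 3, l 1 2, l 1 3, l 2 3, r _ _ 0 1, r _ _ 0 2,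
    r _ _ 0 3, r _ _ 1 2, r _ _ 1 3, r _ _ 2 3, p 0 1 0 2, p 0 1 0 3, p 0 1 1 2, p 0 1 1 3,
    p 0 1 2 3, p 0 2 0 3, p 0 2 1 2, p 0 2 1 3, p 0 2 2 3, p 0 3 1 2, p 0 3 1 3, p 0 3 2 3,
    p 1 2 1 3, p 1 2 2 3, p 1 3 2 3, e1, e2, e3, e4, e5, e6, e7, e8, e9, e10, e11] <;> ring

end IsEuclideanWeyl

/-- Components `T_{abcde}` of a covariant tensor of rank five at a point. -/
abbrev Tensor5 : Type := Fin 4 → Fin 4 → Fin 4 → Fin 4 → Fin 4 → ℂ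

/-- The Euclidean contraction `A_{abcd} B_{abcd}`. -/
def inner4 (A B : Tensor4 ℂ) : ℂ := ∑ a, ∑ b, ∑ c, ∑ d, A a b c d * B a b c d

/-- The Euclidean contraction `X_{abcde} Y_{abcde}`. -/
def inner5 (X Y : Tensor5) : ℂ := ∑ a, ∑ b, ∑ c, ∑ d, ∑ e, X a b c d e * Y a b c d e

/-- Exchange of the first and the last index. -/
def swapAE (X : Tensor5) : Tensor5 := fun a b c d e => X e b c d a

/-! ### Euclidean contractions, index permutations and the polarised identity. -/

theorem sum_rotate (f : Fin 4 → Fin 4 → Fin 4 → Fin 4 → ℂ) :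
    ∑ b, ∑ c, ∑ d, ∑ e, f b c d e = ∑ e, ∑ b, ∑ c, ∑ d, f b c d e := by
  rw [Finset.sum_comm (s := Finset.univ) (t := Finset.univ)
    (f := fun e b => ∑ c, ∑ d, f b c d e)]
  refine Finset.sum_congr rfl fun b _ => ?_
  rw [Finset.sum_comm (s := Finset.univ) (t := Finset.univ) (f := fun e c => ∑ d, f b c d e)]
  exact Finset.sum_congr rfl fun c _ => Finset.sum_comm

theorem inner4_comm (A B : Tensor4 ℂ) : inner4 A B = inner4 B A := by
  simp only [inner4, mul_comm]

theorem inner5_comm (X Y : Tensor5) : inner5 X Y = inner5 Y X := by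
  simp only [inner5, mul_comm]

theorem inner5_add_left (X Y Z : Tensor5) : inner5 (X + Y) Z = inner5 X Z + inner5 Y Z := by
  simp [inner5, add_mul, Finset.sum_add_distrib]

theorem inner5_add_right (X Y Z : Tensor5) : inner5 Z (X + Y) = inner5 Z X + inner5 Z Y := by
  simp [inner5, mul_add, Finset.sum_add_distrib]

theorem inner5_sub_right (X Y Z : Tensor5) : inner5 Z (X - Y) = inner5 Z X - inner5 Z Y := by
  simp [inner5, mul_sub, Finset.sum_sub_distrib]

theorem inner5_neg_right (X Z : Tensor5) : inner5 Z (-X) = -inner5 Z X := by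
  simp [inner5, Finset.sum_neg_distrib]

theorem inner5_smul_right (r : ℂ) (X Z : Tensor5) : inner5 Z (r • X) = r * inner5 Z X := by
  simp only [inner5, Finset.mul_sum, Pi.smul_apply, smul_eq_mul, mul_left_comm]

theorem inner5_ab (X Y : Tensor5) :
    inner5 X Y = inner5 (fun a b c d e => X b a c d e) (fun a b c d e => Y b a c d e) := by
  unfold inner5; rw [Finset.sum_comm]

theorem inner5_cd (X Y : Tensor5) :
    inner5 X Y = inner5 (fun a b c d e => X a b d c e) (fun a b c d e => Y a b d c e) :=
  Finset.sum_congr rfl fun _ _ => Finset.sum_congr rfl fun _ _ => Finset.sum_comm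

theorem inner5_bc (X Y : Tensor5) :
    inner5 X Y = inner5 (fun a b c d e => X a c b d e) (fun a b c d e => Y a c b d e) :=
  Finset.sum_congr rfl fun _ _ => Finset.sum_comm

theorem inner5_de (X Y : Tensor5) :
    inner5 X Y = inner5 (fun a b c d e => X a b c e d) (fun a b c d e => Y a b c e d) :=
  Finset.sum_congr rfl fun _ _ => Finset.sum_congr rfl fun _ _ => Finset.sum_congr rfl fun _ _ =>
    Finset.sum_comm

theorem inner5_swapAE (X Y : Tensor5) : inner5 X Y = inner5 (swapAE X) (swapAE Y) := by
  rw [inner5_ab, inner5_bc, inner5_cd, inner5_de, inner5_cd, inner5_bc, inner5_ab]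
  rfl

theorem inner5_pairs (X Y : Tensor5) :
    inner5 X Y = inner5 (fun a b c d e => X c d a b e) (fun a b c d e => Y c d a b e) := by
  rw [inner5_bc, inner5_ab, inner5_cd, inner5_bc]

/-- The rank five tensors `D_{abcde}` that are Weyl-like in `abcd`. -/
def IsEuclideanWeyl5 (D : Tensor5) : Prop := ∀ e, IsEuclideanWeyl fun a b c d => D a b c d e

/-- `u_a W_{ebcd} - g_{ea} u^f W_{fbcd}` for the Euclidean metric. -/
def shear (W : Tensor4 ℂ) (u : Fin 4 → ℂ) : Tensor5 := fun a b c d e =>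
  u a * W e b c d - if e = a then ∑ f, u f * W f b c d else 0

/-- The change of the covariant derivative of a conformally covariant Weyl-like tensor, for the
Euclidean metric. -/
def shift (W : Tensor4 ℂ) (u : Fin 4 → ℂ) : Tensor5 := fun a b c d e =>
  -2 * (u e * W a b c d) - (shear W u a b c d e - shear W u b a c d e + shear W u c d a b e
    - shear W u d c a b e)

namespace IsEuclideanWeyl

variable {W : Tensor4 ℂ} (hW : IsEuclideanWeyl W)
include hW

theorem inner4_self_eq (a : Fin 4) :
    ∑ b, ∑ c, ∑ d, W a b c d * W a b c d = (1 / 4 : ℂ) * inner4 W W := by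
  have h : ∀ a, ∑ b, ∑ c, ∑ d, W a b c d * W a b c d = ∑ b, ∑ c, ∑ d, W 0 b c d * W 0 b c d :=
    fun a => by rw [hW.sum_mul_self_eq a a, if_pos rfl]
  rw [inner4, Finset.sum_congr rfl fun a _ => h a, h a]
  simp

/-- The quadratic identity for `W + D`, minus those for `W` and `D`, leaves the mixed terms. -/
theorem polarized {D : Tensor4 ℂ} (hD : IsEuclideanWeyl D) (a e : Fin 4) :
    (∑ b, ∑ c, ∑ d, D a b c d * W e b c d) + ∑ b, ∑ c, ∑ d, W a b c d * D e b c d =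
      if a = e then (1 / 2 : ℂ) * inner4 W D else 0 := by
  have hs : ∀ T : Tensor4 ℂ, IsEuclideanWeyl T → ∑ b, ∑ c, ∑ d, T a b c d * T e b c d =
      if a = e then (1 / 4 : ℂ) * inner4 T T else 0 := fun T hT => by
    split_ifs with h
    · subst h; exact hT.inner4_self_eq a
    · rw [hT.sum_mul_self_eq, if_neg h]
  have h1 := hs _ (hW.add hD)
  have h2 := hs _ hW
  have h3 := hs _ hD
  have h4 : inner4 (fun a b c d => W a b c d + D a b c d) (fun a b c d => W a b c d + D a b c d) =
      inner4 W W + 2 * inner4 W D + inner4 D D := by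
    rw [two_mul]; nth_rewrite 2 [inner4_comm W D]
    simp only [inner4, ← Finset.sum_add_distrib]
    refine Finset.sum_congr rfl fun _ _ => Finset.sum_congr rfl fun _ _ =>
      Finset.sum_congr rfl fun _ _ => Finset.sum_congr rfl fun _ _ => by ring
  have h5 : ∑ b, ∑ c, ∑ d, (W a b c d + D a b c d) * (W e b c d + D e b c d) =
      (∑ b, ∑ c, ∑ d, W a b c d * W e b c d) + (∑ b, ∑ c, ∑ d, D a b c d * D e b c d)
      + ((∑ b, ∑ c, ∑ d, D a b c d * W e b c d) + ∑ b, ∑ c, ∑ d, W a b c d * D e b c d) := by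
    simp only [← Finset.sum_add_distrib]
    refine Finset.sum_congr rfl fun _ _ => Finset.sum_congr rfl fun _ _ =>
      Finset.sum_congr rfl fun _ _ => by ring
  rw [h5, h4, h2, h3] at h1
  split_ifs at h1 ⊢ <;> linear_combination h1

theorem shear_antisymm (u : Fin 4 → ℂ) (a b c d e : Fin 4) :
    shear W u a b d c e = -shear W u a b c d e := by
  simp only [shear, hW.antisymm_right _ b c d, mul_neg, Finset.sum_neg_distrib]
  split_ifs <;> ring

theorem shear_bianchi (u : Fin 4 → ℂ) (a b c d e : Fin 4) :
    shear W u a b c d e + shear W u a c d b e + shear W u a d b c e = 0 := by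
  have h1 : ∑ f, u f * W f b c d + ∑ f, u f * W f c d b + ∑ f, u f * W f d b c = 0 := by
    simp only [← Finset.sum_add_distrib, ← mul_add, hW.bianchi]; simp
  simp only [shear]
  split_ifs
  · linear_combination u a * hW.bianchi e b c d - h1
  · linear_combination u a * hW.bianchi e b c d

/-- This lets the contraction formulas for a Weyl-like `D` be applied to the shift itself, which
yields the terms quadratic in `u`. -/
theorem shift_isEuclideanWeyl5 (u : Fin 4 → ℂ) : IsEuclideanWeyl5 (shift W u) := by
  intro e
  have r := hW.shear_antisymm u
  have B := hW.shear_bianchi u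
  refine ⟨fun a b c d => ?_, fun a b c d => ?_, fun a b c d => ?_, fun a b c d => ?_,
    fun b d => ?_⟩ <;> simp only [shift]
  · rw [hW.antisymm_left a b, r c d a b, r d c a b]; ring
  · rw [hW.antisymm_right a b c d, r a b c d, r b a c d]; ring
  · rw [hW.pair_symm a b c d]; ring
  · linear_combination (-2 * u e) * hW.bianchi a b c d - B a b c d e + B b a c d e
      + B c a d b e + B d a b c e - r c d a b e - r d b a c e - r b c a d e
  · have t : ∀ b d, ∑ a, W b a a d = 0 := fun b d => by
      simp only [hW.antisymm_left _ b, Finset.sum_neg_distrib, hW.trace, neg_zero]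
    have h1 : ∀ b d, ∑ a, shear W u a b a d e =
        ∑ a, u a * W e b a d - ∑ f, u f * W f b e d := fun b d => by
      simp [shear, Finset.sum_sub_distrib]
    have h2 : ∀ b d, ∑ a, shear W u b a a d e = 0 := fun b d => by
      have h3 : ∑ a, ∑ f, u f * W f a a d = 0 := by
        rw [Finset.sum_comm]; simp only [← Finset.mul_sum, t]; simp
      by_cases h : e = b
      · simp [shear, Finset.sum_sub_distrib, ← Finset.mul_sum, t, h, h3]
      · simp [shear, ← Finset.mul_sum, t, h]
    simp only [Finset.sum_add_distrib, Finset.sum_sub_distrib, ← Finset.mul_sum, hW.trace, h1, h2]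
    -- The two remaining shear traces, related by exchanging `b` and `d`, cancel by pair symmetry.
    simp only [hW.pair_symm _ _ e b, hW.pair_symm _ _ e d]
    ring

end IsEuclideanWeyl

/-! ### Contractions with the shift and the invariant combination. -/

section Contractions

variable {W : Tensor4 ℂ} (hW : IsEuclideanWeyl W) {D : Tensor5} (hD : IsEuclideanWeyl5 D)
  (u : Fin 4 → ℂ)

include hD in
-- Permuting indices in both factors preserves the contraction, so a symmetry of `D` may be moved
-- onto the other factor; likewise for the right pair and for the exchange of pairs.
theorem inner5_flip_left (Y : Tensor5) :
    inner5 D (fun a b c d e => Y b a c d e) = -inner5 D Y := by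
  rw [inner5_ab, ← inner5_neg_right]
  have : (fun a b c d e => D b a c d e) = -D := by
    funext a b c d e; exact (hD e).antisymm_left a b c d
  rw [this, inner5_comm, inner5_neg_right, inner5_comm, inner5_neg_right]

include hD in
theorem inner5_flip_right (Y : Tensor5) :
    inner5 D (fun a b c d e => Y a b d c e) = -inner5 D Y := by
  rw [inner5_cd]
  have : (fun a b c d e => D a b d c e) = -D := by
    funext a b c d e; exact (hD e).antisymm_right a b c d
  rw [this, inner5_comm, inner5_neg_right, inner5_comm]

include hD in
theorem inner5_exchange (Y : Tensor5) :
    inner5 D (fun a b c d e => Y c d a b e) = inner5 D Y := by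
  rw [inner5_pairs]
  have : (fun a b c d e => D c d a b e) = D := by
    funext a b c d e; exact (hD e).pair_symm a b c d
  rw [this]

include hD in
-- The four shear terms are carried to one another by the symmetries of `D`, with matching signs,
-- and so contribute equally.
theorem inner5_shift : inner5 D (shift W u) =
    -2 * inner5 D (fun a b c d e => u e * W a b c d) - 4 * inner5 D (shear W u) := by
  have e : shift W u = (-2 : ℂ) • (fun a b c d e => u e * W a b c d) -
      (shear W u - (fun a b c d e => shear W u b a c d e)
        + (fun a b c d e => shear W u c d a b e) - fun a b c d e => shear W u d c a b e) := by
    funext a b c d e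
    simp [shift]
  rw [e, inner5_sub_right, inner5_smul_right, inner5_sub_right, inner5_add_right, inner5_sub_right,
    inner5_flip_left hD (shear W u), inner5_exchange hD (shear W u),
    inner5_flip_right hD (fun a b c d e => shear W u c d a b e),
    inner5_exchange hD (shear W u)]
  ring

include hW hD in
/-- The contracted polarised four-dimensional identity. -/
theorem inner5_add_trace :
    inner5 D (fun a b c d e => u a * W e b c d) +
      inner5 D (fun a b c d e => if e = a then ∑ f, u f * W f b c d else 0) =
      (1 / 2 : ℂ) * inner5 D (fun a b c d e => u e * W a b c d) := by
  -- The derivative index of `D` is identified with the first free index `a`; weighting by `u_e` and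
  -- summing over `a` and `e` gives the three contractions.
  have h := fun a e => hW.polarized (hD a) a e
  have t1 : inner5 D (fun a b c d e => u a * W e b c d) =
      ∑ a, ∑ e, u e * ∑ b, ∑ c, ∑ d, W a b c d * D e b c d a := by
    rw [inner5_swapAE]
    refine Finset.sum_congr rfl fun a _ => ?_
    rw [sum_rotate]
    simp only [Finset.mul_sum, swapAE]
    refine Finset.sum_congr rfl fun e _ => Finset.sum_congr rfl fun b _ =>
      Finset.sum_congr rfl fun c _ => Finset.sum_congr rfl fun d _ => by ring
  have t2 : inner5 D (fun a b c d e => if e = a then ∑ f, u f * W f b c d else 0) =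
      ∑ a, ∑ e, u e * ∑ b, ∑ c, ∑ d, D a b c d a * W e b c d := by
    refine Finset.sum_congr rfl fun a _ => ?_
    simp only [mul_ite, mul_zero, Finset.sum_ite_eq', Finset.mem_univ, if_true, Finset.mul_sum]
    rw [sum_rotate]
    refine Finset.sum_congr rfl fun e _ => Finset.sum_congr rfl fun b _ =>
      Finset.sum_congr rfl fun c _ => Finset.sum_congr rfl fun d _ => by ring
  have t3 : inner5 D (fun a b c d e => u e * W a b c d) =
      ∑ a, u a * inner4 W (fun a' b c d => D a' b c d a) := by
    unfold inner5 inner4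
    simp only [Finset.mul_sum]
    rw [Finset.sum_congr rfl fun a _ => sum_rotate _, Finset.sum_comm]
    refine Finset.sum_congr rfl fun e _ => Finset.sum_congr rfl fun a _ =>
      Finset.sum_congr rfl fun b _ => Finset.sum_congr rfl fun c _ =>
      Finset.sum_congr rfl fun d _ => by ring
  have h1 : ∑ a, ∑ e, u e * ((∑ b, ∑ c, ∑ d, D a b c d a * W e b c d) +
      ∑ b, ∑ c, ∑ d, W a b c d * D e b c d a) =
      ∑ a, u a * ((1 / 2 : ℂ) * inner4 W (fun a' b c d => D a' b c d a)) := by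
    simp [h]
  simp only [mul_add, Finset.sum_add_distrib] at h1
  rw [t1, t2, t3, add_comm, h1, Finset.mul_sum]
  exact Finset.sum_congr rfl fun a _ => by ring

include hW hD in
-- The cyclic identity gives `W_{ebcd} = W_{edcb} - W_{ecdb}`. The two terms on the right differ by
-- exchanging `c` and `d`, under which `D` is odd, so they contribute equally.
theorem inner5_bianchi :
    inner5 D (fun a b c d e => u a * W e d c b) =
      (1 / 2 : ℂ) * inner5 D (fun a b c d e => u a * W e b c d) := by
  have h1 := inner5_flip_right hD (fun a b c d e => u a * W e d c b)
  have h2 : inner5 D (fun a b c d e => u a * W e b c d) =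
      inner5 D (fun a b c d e => u a * W e d c b)
        - inner5 D (fun a b c d e => u a * W e c d b) := by
    rw [← inner5_sub_right]
    congr 1
    funext a b c d e
    have := hW.antisymm_right e d b c
    simp only [Pi.sub_apply]
    linear_combination u a * hW.bianchi e b c d - u a * this
  linear_combination (-1 / 2 : ℂ) * h2 + (1 / 2 : ℂ) * h1

include hW hD in
-- The polarised identity removes the trace term of the shear, and the `u_e W_{abcd}` contributions
-- cancel.
theorem inner5_shift_eq : inner5 D (shift W u) =
    -8 * inner5 D (fun a b c d e => u a * W e b c d) := by
  have h := inner5_add_trace hW hD u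
  have e : shear W u = (fun a b c d e => u a * W e b c d) -
    (fun a b c d e => if e = a then ∑ f, u f * W f b c d else 0) := rfl
  rw [inner5_shift hD, e, inner5_sub_right]
  linear_combination 4 * h

include hW hD in
-- After the swap, most metric terms pair two indices of `D` and vanish by its antisymmetry or
-- tracelessness. The one metric term left is eliminated by the polarised identity, and the terms
-- with permuted `W` are reduced by the Bianchi identity.
theorem inner5_swapAE_shift : inner5 D (swapAE (shift W u)) =
    -3 * inner5 D (fun a b c d e => u a * W e b c d)
      - (1 / 2 : ℂ) * inner5 D (fun a b c d e => u e * W a b c d) := by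
  have e : swapAE (shift W u) = (-2 : ℂ) • (fun a b c d e => u a * W e b c d) -
      ((fun a b c d e => shear W u e b c d a) - (fun a b c d e => shear W u b e c d a)
        + (fun a b c d e => shear W u c d e b a) - fun a b c d e => shear W u d c e b a) := by
    funext a b c d e
    simp [shift, swapAE]
  have h1 : inner5 D (fun a b c d e => shear W u e b c d a) =
      inner5 D (fun a b c d e => u e * W a b c d) -
        inner5 D (fun a b c d e => if e = a then ∑ f, u f * W f b c d else 0) := by
    rw [← inner5_sub_right]
    congr 1
    funext a b c d e
    simp only [shear, Pi.sub_apply, eq_comm]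
  have h2 : inner5 D (fun a b c d e => shear W u b e c d a) =
      inner5 D (fun a b c d e => u a * W e b c d) := by
    have z : inner5 D (fun a b c d e => if a = b then ∑ f, u f * W f e c d else 0) = 0 := by
      have := fun a c d e => (hD e).left_self a c d
      simp [inner5, this]
    have s : (fun a b c d e => shear W u b e c d a) = (fun a b c d e => u b * W a e c d) -
      (fun a b c d e => if a = b then ∑ f, u f * W f e c d else 0) := rfl
    rw [s, inner5_sub_right, z, sub_zero, ← neg_inj,
      ← inner5_flip_left hD (fun a b c d e => u a * W e b c d), ← inner5_neg_right]
    congr 1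
    funext a b c d e
    simp only [Pi.neg_apply]
    rw [hW.antisymm_left a e c d]; ring
  have h3 : inner5 D (fun a b c d e => shear W u c d e b a) =
      (1 / 2 : ℂ) * inner5 D (fun a b c d e => u a * W e b c d) := by
    have z : inner5 D (fun a b c d e => if a = c then ∑ f, u f * W f d e b else 0) = 0 := by
      simp only [inner5, mul_ite, mul_zero]
      have h : ∀ a b, ∑ c, ∑ d, ∑ e, (if a = c then D a b c d e * ∑ f, u f * W f d e b else 0) =
          ∑ d, ∑ e, D a b a d e * ∑ f, u f * W f d e b := fun a b => by
        rw [Finset.sum_eq_single a (fun c _ hc => by simp [hc.symm]) (by simp)]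
        simp
      simp only [h]
      rw [Finset.sum_comm]
      refine Finset.sum_eq_zero fun b _ => ?_
      rw [Finset.sum_comm]
      refine Finset.sum_eq_zero fun d _ => ?_
      rw [Finset.sum_comm]
      refine Finset.sum_eq_zero fun e _ => ?_
      rw [← Finset.sum_mul, (hD e).trace, zero_mul]
    have s : (fun a b c d e => shear W u c d e b a) = (fun a b c d e => u c * W a d e b) -
      (fun a b c d e => if a = c then ∑ f, u f * W f d e b else 0) := rfl
    rw [s, inner5_sub_right, z, sub_zero, ← inner5_bianchi hW hD,
      ← inner5_exchange hD (fun a b c d e => u a * W e d c b)]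
    congr 1
    funext a b c d e
    rw [hW.pair_symm a d e b]
  have h4 := inner5_flip_right hD (fun a b c d e => shear W u c d e b a)
  rw [e, inner5_sub_right, inner5_smul_right, inner5_sub_right, inner5_add_right, inner5_sub_right,
    h1, h2, h4, h3]
  linear_combination inner5_add_trace hW hD u

include hW hD in
/-- The combination of contractions that is invariant under a conformal change. -/
theorem six_inner5_sub_sixteen_inner5_swapAE :
    6 * inner5 (D + shift W u) (D + shift W u)
        - 16 * inner5 (D + shift W u) (swapAE (D + shift W u)) =
      6 * inner5 D D - 16 * inner5 D (swapAE D)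
        + 16 * inner5 D (fun a b c d e => u e * W a b c d)
        - 16 * inner4 W W * ∑ e, u e * u e := by
  have hA := hW.shift_isEuclideanWeyl5 u
  have hU : IsEuclideanWeyl5 (fun a b c d e => u e * W a b c d) := by
    intro e
    refine ⟨fun a b c d => ?_, fun a b c d => ?_, fun a b c d => ?_, fun a b c d => ?_,
      fun b d => ?_⟩ <;> beta_reduce
    · rw [hW.antisymm_left]; ring
    · rw [hW.antisymm_right]; ring
    · rw [hW.pair_symm]
    · linear_combination u e * hW.bianchi a b c d
    · rw [← Finset.mul_sum, hW.trace, mul_zero]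
  have d1 := inner5_shift_eq hW hD u
  have d2 := inner5_swapAE_shift hW hD u
  have a1 := inner5_shift_eq hW hA u
  have a2 := inner5_swapAE_shift hW hA u
  have u1 := inner5_shift_eq hW hU u
  have u2 : inner5 (fun a b c d e => u e * W a b c d) (fun a b c d e => u a * W e b c d) =
      (1 / 4 : ℂ) * inner4 W W * ∑ e, u e * u e := by
    have hd : ∀ a e, ∑ b, ∑ c, ∑ d, W a b c d * W e b c d =
        if a = e then (1 / 4 : ℂ) * inner4 W W else 0 := fun a e => by
      split_ifs with h
      · subst h; exact hW.inner4_self_eq a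
      · rw [hW.sum_mul_self_eq, if_neg h]
    have : ∀ a e, ∑ b, ∑ c, ∑ d, u e * W a b c d * (u a * W e b c d) =
        u e * u a * ∑ b, ∑ c, ∑ d, W a b c d * W e b c d := fun a e => by
      simp only [Finset.mul_sum]
      refine Finset.sum_congr rfl fun b _ => Finset.sum_congr rfl fun c _ =>
        Finset.sum_congr rfl fun d _ => by ring
    unfold inner5
    rw [Finset.sum_congr rfl fun a _ => sum_rotate _]
    simp only [this, hd, mul_ite, mul_zero, Finset.sum_ite_eq, Finset.mem_univ, if_true,
      Finset.mul_sum]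
    exact Finset.sum_congr rfl fun a _ => by ring
  rw [inner5_comm] at u1
  have hsw : swapAE (D + shift W u) = swapAE D + swapAE (shift W u) := rfl
  have hc : inner5 (shift W u) (swapAE D) = inner5 D (swapAE (shift W u)) := by
    rw [inner5_swapAE, inner5_comm]; rfl
  -- With `P` and `Q` the contractions of `D` with `u_e W_{abcd}` and `u_a W_{ebcd}`, the linear
  -- terms are `2(6·(-8Q) - 16·(-3Q - P/2)) = 16P`. The quadratic terms are likewise `8P` with `D`
  -- replaced by the shift, that is `8·(-8)·¼ |W|² |u|²`.
  rw [hsw, inner5_add_left, inner5_add_left, inner5_add_right, inner5_add_right, inner5_add_right,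
    inner5_add_right, hc, inner5_comm (shift W u) D, d1, d2, a1, a2, u1, u2]
  ring

end Contractions

theorem IsWeylLike.cyclic {g : Matrix (Fin 4) (Fin 4) ℝ} {T : Tensor4 ℂ} (hT : IsWeylLike g T)
    (a b c d : Fin 4) : T a b c d + T a c d b + T a d b c = 0 := by
  have h1 := hT.bianchi a b c d
  simp only [antisymBCD, hT.antisymm_right a b c d, hT.antisymm_right a c d b,
    hT.antisymm_right a d b c, Complex.real_smul] at h1
  push_cast at h1
  linear_combination 3 * h1

/-- The contraction `h^{ap} F_{ap}`. -/
def contract (h : Matrix (Fin 4) (Fin 4) ℝ) (F : Fin 4 → Fin 4 → ℂ) : ℂ :=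
  ∑ a, ∑ p, (h a p : ℂ) * F a p

/-! ### Contraction of tensors with the inverse metric. -/

section Contract

variable (h : Matrix (Fin 4) (Fin 4) ℝ)

theorem contract_add (F G : Fin 4 → Fin 4 → ℂ) :
    contract h (fun a p => F a p + G a p) = contract h F + contract h G := by
  simp [contract, mul_add, Finset.sum_add_distrib]

theorem contract_sub (F G : Fin 4 → Fin 4 → ℂ) :
    contract h (fun a p => F a p - G a p) = contract h F - contract h G := by
  simp [contract, mul_sub, Finset.sum_sub_distrib]

theorem contract_const_mul (k : ℂ) (F : Fin 4 → Fin 4 → ℂ) :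
    contract h (fun a p => k * F a p) = k * contract h F := by
  simp only [contract, Finset.mul_sum, mul_left_comm]

theorem contract_sum {ι : Type*} (s : Finset ι) (F : ι → Fin 4 → Fin 4 → ℂ) :
    contract h (fun a p => ∑ k ∈ s, F k a p) = ∑ k ∈ s, contract h (F k) := by
  simp only [contract, Finset.mul_sum]
  rw [Finset.sum_congr rfl fun a _ => Finset.sum_comm, Finset.sum_comm]

theorem contract_smul (r : ℝ) (F : Fin 4 → Fin 4 → ℂ) :
    contract (r • h) F = (r : ℂ) * contract h F := by
  simp [contract, Finset.mul_sum, mul_assoc]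

theorem contract_swap {h : Matrix (Fin 4) (Fin 4) ℝ} (hs : ∀ i j, h i j = h j i)
    (F : Fin 4 → Fin 4 → ℂ) : contract h F = contract h fun a p => F p a := by
  unfold contract
  rw [Finset.sum_comm]
  simp only [hs]

theorem trace13_eq_contract (g : Matrix (Fin 4) (Fin 4) ℝ) (T : Tensor4 ℂ) (b d : Fin 4) :
    trace13 g T b d = contract g⁻¹ fun a c => T a b c d := by
  simp [trace13, contract]

/-- The full contraction of two tensors of rank four with `h`. -/
def contract4 (A B : Tensor4 ℂ) : ℂ :=
  contract h fun d s => contract h fun c r => contract h fun b q => contract h fun a p =>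
    A a b c d * B p q r s

/-- The full contraction of two tensors of rank five with `h`. -/
def contract5 (X Y : Tensor5) : ℂ :=
  contract h fun e t => contract h fun d s => contract h fun c r => contract h fun b q =>
    contract h fun a p => X a b c d e * Y p q r s t

theorem contract4_comm {h : Matrix (Fin 4) (Fin 4) ℝ} (hs : ∀ i j, h i j = h j i)
    (A B : Tensor4 ℂ) : contract4 h A B = contract4 h B A := by
  unfold contract4
  rw [contract_swap hs]
  refine congrArg _ (funext fun d => funext fun s => ?_)
  rw [contract_swap hs]
  refine congrArg _ (funext fun c => funext fun r => ?_)
  rw [contract_swap hs]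
  refine congrArg _ (funext fun b => funext fun q => ?_)
  rw [contract_swap hs]
  simp only [mul_comm]

/-- Regrouping the sum into nested contractions of index pairs lets linearity, metric compatibility
and the passage to a frame be applied one pair at a time. -/
theorem sum_eq_contract4 (A B : Tensor4 ℂ) :
    ∑ a, ∑ b, ∑ c, ∑ d, ∑ p, ∑ q, ∑ r, ∑ s, ((h a p * h b q * h c r * h d s : ℝ) : ℂ) *
      (A a b c d * B p q r s) = contract4 h A B := by
  let F := Fin 4
  let e : F × F × F × F × F × F × F × F ≃ F × F × F × F × F × F × F × F :=
    ⟨fun (a, b, c, d, p, q, r, s) => (d, s, c, r, b, q, a, p),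
     fun (d, s, c, r, b, q, a, p) => (a, b, c, d, p, q, r, s),
     fun _ => rfl, fun _ => rfl⟩
  have := Fintype.sum_equiv e
    (fun (a, b, c, d, p, q, r, s) =>
      ((h a p * h b q * h c r * h d s : ℝ) : ℂ) * (A a b c d * B p q r s))
    (fun (d, s, c, r, b, q, a, p) =>
      ((h a p * h b q * h c r * h d s : ℝ) : ℂ) * (A a b c d * B p q r s)) (fun _ => rfl)
  simp only [F, Fintype.sum_prod_type] at this
  rw [this]
  simp only [contract4, contract, Finset.mul_sum]
  refine Finset.sum_congr rfl fun _ _ => Finset.sum_congr rfl fun _ _ =>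
    Finset.sum_congr rfl fun _ _ => Finset.sum_congr rfl fun _ _ =>
    Finset.sum_congr rfl fun _ _ => Finset.sum_congr rfl fun _ _ =>
    Finset.sum_congr rfl fun _ _ => Finset.sum_congr rfl fun _ _ => ?_
  push_cast
  ring

theorem sum_eq_contract5 (X Y : Tensor5) :
    ∑ a, ∑ b, ∑ c, ∑ d, ∑ e, ∑ p, ∑ q, ∑ r, ∑ s, ∑ t,
      ((h a p * h b q * h c r * h d s * h e t : ℝ) : ℂ) *
      (X a b c d e * Y p q r s t) = contract5 h X Y := by
  let F := Fin 4
  let i : F × F × F × F × F × F × F × F × F × F ≃ F × F × F × F × F × F × F × F × F × F :=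
    ⟨fun (a, b, c, d, e, p, q, r, s, t) => (e, t, d, s, c, r, b, q, a, p),
     fun (e, t, d, s, c, r, b, q, a, p) => (a, b, c, d, e, p, q, r, s, t),
     fun _ => rfl, fun _ => rfl⟩
  have := Fintype.sum_equiv i
    (fun (a, b, c, d, e, p, q, r, s, t) =>
      ((h a p * h b q * h c r * h d s * h e t : ℝ) : ℂ) * (X a b c d e * Y p q r s t))
    (fun (e, t, d, s, c, r, b, q, a, p) =>
      ((h a p * h b q * h c r * h d s * h e t : ℝ) : ℂ) * (X a b c d e * Y p q r s t))
    (fun _ => rfl)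
  simp only [F, Fintype.sum_prod_type] at this
  rw [this]
  simp only [contract5, contract, Finset.mul_sum]
  refine Finset.sum_congr rfl fun _ _ => Finset.sum_congr rfl fun _ _ =>
    Finset.sum_congr rfl fun _ _ => Finset.sum_congr rfl fun _ _ =>
    Finset.sum_congr rfl fun _ _ => Finset.sum_congr rfl fun _ _ =>
    Finset.sum_congr rfl fun _ _ => Finset.sum_congr rfl fun _ _ =>
    Finset.sum_congr rfl fun _ _ => Finset.sum_congr rfl fun _ _ => ?_
  push_cast
  ring

end Contract

/-! ### Components in a complex orthonormal frame -/

/-- The component of a covector along the `i`-th frame vector `E_{·i}`. -/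
def frame1 (E : Matrix (Fin 4) (Fin 4) ℂ) (i : Fin 4) (f : Fin 4 → ℂ) : ℂ := ∑ a, E a i * f a

/-- The components of a tensor of rank four in a frame. -/
def frame4 (E : Matrix (Fin 4) (Fin 4) ℂ) (A : Tensor4 ℂ) : Tensor4 ℂ := fun i j k l =>
  frame1 E l fun d => frame1 E k fun c => frame1 E j fun b => frame1 E i fun a => A a b c d

/-- The components of a tensor of rank five in a frame. -/
def frame5 (E : Matrix (Fin 4) (Fin 4) ℂ) (X : Tensor5) : Tensor5 := fun i j k l m =>
  frame1 E m fun e => frame1 E l fun d => frame1 E k fun c => frame1 E j fun b =>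
    frame1 E i fun a => X a b c d e

section Frame

variable (E : Matrix (Fin 4) (Fin 4) ℂ)

theorem frame1_add (i : Fin 4) (f k : Fin 4 → ℂ) :
    frame1 E i (fun a => f a + k a) = frame1 E i f + frame1 E i k := by
  simp [frame1, mul_add, Finset.sum_add_distrib]

theorem frame1_sub (i : Fin 4) (f k : Fin 4 → ℂ) :
    frame1 E i (fun a => f a - k a) = frame1 E i f - frame1 E i k := by
  simp [frame1, mul_sub, Finset.sum_sub_distrib]

theorem frame1_neg (i : Fin 4) (f : Fin 4 → ℂ) :
    frame1 E i (fun a => -f a) = -frame1 E i f := by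
  simp [frame1]

theorem frame1_zero (i : Fin 4) : frame1 E i (fun _ => 0) = 0 := by
  simp [frame1]

theorem frame1_const_mul (i : Fin 4) (k : ℂ) (f : Fin 4 → ℂ) :
    frame1 E i (fun a => k * f a) = k * frame1 E i f := by
  simp only [frame1, Finset.mul_sum, mul_left_comm]

theorem frame1_mul_const (i : Fin 4) (k : ℂ) (f : Fin 4 → ℂ) :
    frame1 E i (fun a => f a * k) = frame1 E i f * k := by
  simp only [frame1, Finset.sum_mul, mul_assoc]

theorem frame1_sum (i : Fin 4) (f : Fin 4 → Fin 4 → ℂ) :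
    frame1 E i (fun a => ∑ n, f n a) = ∑ n, frame1 E i (f n) := by
  simp only [frame1, Finset.mul_sum]
  rw [Finset.sum_comm]

theorem frame1_comm (i j : Fin 4) (f : Fin 4 → Fin 4 → ℂ) :
    frame1 E i (fun a => frame1 E j fun b => f a b) =
      frame1 E j (fun b => frame1 E i fun a => f a b) := by
  simp only [frame1, Finset.mul_sum]
  rw [Finset.sum_comm]
  simp only [mul_left_comm]

theorem frame4_ab (A : Tensor4 ℂ) (i j k l : Fin 4) :
    frame4 E (fun a b c d => A b a c d) i j k l = frame4 E A j i k l :=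
  congrArg _ (funext fun d => congrArg _ (funext fun c => frame1_comm E j i fun b a => A b a c d))

theorem frame4_bc (A : Tensor4 ℂ) (i j k l : Fin 4) :
    frame4 E (fun a b c d => A a c b d) i j k l = frame4 E A i k j l :=
  congrArg _ (funext fun d => frame1_comm E k j fun c b => frame1 E i fun a => A a c b d)

theorem frame4_cd (A : Tensor4 ℂ) (i j k l : Fin 4) :
    frame4 E (fun a b c d => A a b d c) i j k l = frame4 E A i j l k :=
  frame1_comm E l k fun d c => frame1 E j fun b => frame1 E i fun a => A a b d c

theorem frame5_eq_frame4 (X : Tensor5) (i j k l m : Fin 4) :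
    frame5 E X i j k l m = frame1 E m fun e => frame4 E (fun a b c d => X a b c d e) i j k l :=
  rfl

theorem frame5_eq_frame4' (X : Tensor5) (i j k l m : Fin 4) :
    frame5 E X i j k l m = frame4 E (fun a b c d => frame1 E m fun e => X a b c d e) i j k l := by
  simp only [frame5, frame4]
  rw [frame1_comm]
  refine congrArg _ (funext fun d => ?_)
  rw [frame1_comm]
  refine congrArg _ (funext fun c => ?_)
  rw [frame1_comm]
  refine congrArg _ (funext fun b => ?_)
  rw [frame1_comm]

theorem frame5_ab (X : Tensor5) (i j k l m : Fin 4) :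
    frame5 E (fun a b c d e => X b a c d e) i j k l m = frame5 E X j i k l m :=
  (frame5_eq_frame4 E _ i j k l m).trans (congrArg (frame1 E m) (funext fun e =>
    frame4_ab E (fun a b c d => X a b c d e) i j k l))

theorem frame5_bc (X : Tensor5) (i j k l m : Fin 4) :
    frame5 E (fun a b c d e => X a c b d e) i j k l m = frame5 E X i k j l m :=
  (frame5_eq_frame4 E _ i j k l m).trans (congrArg (frame1 E m) (funext fun e =>
    frame4_bc E (fun a b c d => X a b c d e) i j k l))

theorem frame5_cd (X : Tensor5) (i j k l m : Fin 4) :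
    frame5 E (fun a b c d e => X a b d c e) i j k l m = frame5 E X i j l k m :=
  (frame5_eq_frame4 E _ i j k l m).trans (congrArg (frame1 E m) (funext fun e =>
    frame4_cd E (fun a b c d => X a b c d e) i j k l))

theorem frame5_exchange (X : Tensor5) (i j k l m : Fin 4) :
    frame5 E (fun a b c d e => X c d a b e) i j k l m = frame5 E X k l i j m := by
  rw [frame5_bc E (fun a b c d e => X b d a c e), frame5_ab E (fun a b c d e => X a d b c e),
    frame5_cd E (fun a b c d e => X a c b d e), frame5_bc E X]

theorem frame5_swapAE (X : Tensor5) : frame5 E (swapAE X) = swapAE (frame5 E X) := by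
  funext i j k l m
  simp only [swapAE]
  rw [frame5_eq_frame4, frame5_eq_frame4']
  change (frame1 E m fun a => frame1 E l fun d => frame1 E k fun c => frame1 E j fun b =>
    frame1 E i fun e => X a b c d e) = _
  rw [frame1_comm]
  refine congrArg _ (funext fun d => ?_)
  rw [frame1_comm]
  refine congrArg _ (funext fun c => ?_)
  rw [frame1_comm]

variable {E} {h : Matrix (Fin 4) (Fin 4) ℝ} (hE : ∀ a p, (h a p : ℂ) = ∑ i, E a i * E p i)
include hE

theorem contract_frame2 (F : Fin 4 → Fin 4 → ℂ) :
    contract h F = ∑ i, frame1 E i fun a => frame1 E i fun p => F a p := by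
  simp only [contract, hE, frame1, Finset.sum_mul, Finset.mul_sum]
  rw [Finset.sum_congr rfl fun a _ => Finset.sum_comm, Finset.sum_comm]
  simp only [mul_assoc]

theorem contract_mul (x y : Fin 4 → ℂ) :
    contract h (fun a p => x a * y p) = ∑ i, frame1 E i x * frame1 E i y := by
  rw [contract_frame2 hE]
  simp only [frame1_const_mul, frame1_mul_const]

theorem contract4_eq_inner4 (A B : Tensor4 ℂ) :
    contract4 h A B = inner4 (frame4 E A) (frame4 E B) := by
  simp only [contract4, contract_mul hE, contract_sum, inner4, frame4]

theorem contract5_eq_inner5 (X Y : Tensor5) :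
    contract5 h X Y = inner5 (frame5 E X) (frame5 E Y) := by
  simp only [contract5, contract_mul hE, contract_sum, inner5, frame5]

/-- The index symmetries pass to the frame by multilinearity. The trace does so because summing over
a repeated frame index is contraction with `E Eᵀ = g⁻¹`. -/
theorem frame4_isEuclideanWeyl {g : Matrix (Fin 4) (Fin 4) ℝ} (hg : g⁻¹ = h) {T : Tensor4 ℂ}
    (hT : IsWeylLike g T) : IsEuclideanWeyl (frame4 E T) where
  antisymm_left i j k l := by
    rw [← frame4_ab]
    have : (fun a b c d => T b a c d) = fun a b c d => -T a b c d := by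
      funext a b c d; exact hT.antisymm_left a b c d
    rw [this]
    simp only [frame4, frame1_neg]
  antisymm_right i j k l := by
    rw [← frame4_cd]
    have : (fun a b c d => T a b d c) = fun a b c d => -T a b c d := by
      funext a b c d; exact hT.antisymm_right a b c d
    rw [this]
    simp only [frame4, frame1_neg]
  pair_symm i j k l := by
    have : (fun a b c d => T c d a b) = T := by
      funext a b c d; exact hT.pair_symm a b c d
    rw [← frame4_bc, ← frame4_cd, ← frame4_ab, ← frame4_bc]
    exact congrArg (fun X => frame4 E X i j k l) this
  bianchi i j k l := by
    have h1 : frame4 E T i k l j = frame4 E (fun a b c d => T a c d b) i j k l := by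
      rw [frame4_bc E (fun a b c d => T a b d c), frame4_cd]
    have h2 : frame4 E T i l j k = frame4 E (fun a b c d => T a d b c) i j k l := by
      rw [frame4_cd E (fun a b c d => T a c b d), frame4_bc]
    rw [h1, h2]
    simp only [frame4, ← frame1_add]
    simp only [hT.cyclic, frame1_zero]
  trace j l := by
    have h1 : ∀ i, frame4 E T i j i l = frame1 E l fun d => frame1 E j fun b =>
        frame1 E i fun a => frame1 E i fun c => T a b c d := fun i => by
      refine congrArg _ (funext fun d => ?_)
      rw [frame1_comm]
      refine congrArg _ (funext fun b => frame1_comm _ _ _ _)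
    simp only [h1, ← frame1_sum, ← contract_frame2 hE]
    simp only [← hg, ← trace13_eq_contract, hT.traceFree, frame1_zero]

end Frame

/-! ### Metric compatibility and the covariant derivative. -/

namespace SmoothMetricOn
variable {O : Set E4} {g : E4 → Matrix (Fin 4) (Fin 4) ℝ} (hg : SmoothMetricOn O g) {y : E4}
  (hy : y ∈ O)
include hg hy

/-- Differentiating `g⁻¹ g = 1` gives the derivative of `g⁻¹` times `g` (`key`); multiplying by
`g⁻¹` on the right isolates it. -/
theorem pderiv_inv (e a p : Fin 4) : pderiv e (fun z => (g z)⁻¹ a p) y =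
    -(∑ f, christoffel g a e f y * (g y)⁻¹ f p) - ∑ f, christoffel g p e f y * (g y)⁻¹ a f := by
  have h1 := hg.differentiable hy
  have h2 := hg.differentiable_inv hy
  have hs := inv_symm (hg.symm y hy)
  have key : ∀ b, ∑ k, pderiv e (fun z => (g z)⁻¹ a k) y * g y k b =
      -(christoffel g a e b y) - ∑ k, (g y)⁻¹ a k * christoffelFirst g b e k y := fun b => by
    have h3 : pderiv e (fun z => ∑ k, (g z)⁻¹ a k * g z k b) y = 0 := by
      have h : ∀ z ∈ O, ∑ k, (g z)⁻¹ a k * g z k b = if a = b then (1 : ℝ) else 0 :=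
        fun z hz => sum_inv_mul (hg.nondeg z hz) a b
      rw [hg.pderiv_congr hy h, pderiv_const]
    rw [pderiv_sum fun k _ => (h2 a k).fun_mul (h1 k b)] at h3
    simp only [pderiv_mul (h2 _ _) (h1 _ _), hg.pderiv_eq_christoffelFirst hy e, mul_add,
      Finset.sum_add_distrib] at h3
    rw [christoffel_eq]
    linear_combination h3
  have h4 : pderiv e (fun z => (g z)⁻¹ a p) y =
      ∑ b, (∑ k, pderiv e (fun z => (g z)⁻¹ a k) y * g y k b) * (g y)⁻¹ b p := by
    simp only [Finset.sum_mul, mul_assoc]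
    rw [Finset.sum_comm]
    simp only [← Finset.mul_sum, sum_mul_inv (hg.nondeg y hy)]
    simp
  rw [h4]
  simp only [key, sub_mul, neg_mul, Finset.sum_sub_distrib, Finset.sum_neg_distrib, Finset.sum_mul]
  congr 1
  rw [Finset.sum_comm]
  refine Finset.sum_congr rfl fun f _ => ?_
  rw [christoffel_eq, Finset.sum_mul]
  exact Finset.sum_congr rfl fun b _ => by rw [hs b p]; ring

/-- Metric compatibility of the Levi-Civita connection, for contractions of a pair of indices. -/
theorem pderiv_contract (e : Fin 4) {F : E4 → Fin 4 → Fin 4 → ℂ}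
    (hF : ∀ a p, DifferentiableAt ℝ (fun z => F z a p) y) :
    pderiv e (fun z => contract (g z)⁻¹ (F z)) y = contract (g y)⁻¹ fun a p =>
      pderiv e (fun z => F z a p) y - ∑ f, (christoffel g f e a y : ℂ) * F y f p
        - ∑ f, (christoffel g f e p y : ℂ) * F y a f := by
  have h2 : ∀ a p, DifferentiableAt ℝ (fun z => (((g z)⁻¹ a p : ℝ) : ℂ)) y := fun a p =>
    (contDiffAt_ofReal (hg.smooth_inv hy a p)).differentiableAt (by simp)
  have h3 : ∀ a p, DifferentiableAt ℝ (fun z => (((g z)⁻¹ a p : ℝ) : ℂ) * F z a p) y := fun a p =>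
    (h2 a p).mul (hF a p)
  have l : pderiv e (fun z => contract (g z)⁻¹ (F z)) y = ∑ a, ∑ p,
      (((pderiv e (fun z => (g z)⁻¹ a p) y : ℝ) : ℂ) * F y a p
        + ((g y)⁻¹ a p : ℂ) * pderiv e (fun z => F z a p) y) := by
    unfold contract
    rw [pderiv_sum fun a _ => by have := h3 a; fun_prop]
    refine Finset.sum_congr rfl fun a _ => ?_
    rw [pderiv_sum fun p _ => h3 a p]
    refine Finset.sum_congr rfl fun p _ => ?_
    rw [pderiv_mul (h2 a p) (hF a p), pderiv_ofReal (hg.differentiable_inv hy a p)]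
  have s1 : ∑ a, ∑ p, ∑ f, (christoffel g a e f y : ℂ) * ((g y)⁻¹ f p : ℂ) * F y a p =
      ∑ a, ∑ p, ∑ f, ((g y)⁻¹ a p : ℂ) * ((christoffel g f e a y : ℂ) * F y f p) := by
    rw [Finset.sum_congr rfl fun a _ => Finset.sum_comm, Finset.sum_comm]
    refine Finset.sum_congr rfl fun f _ => ?_
    rw [Finset.sum_comm]
    exact Finset.sum_congr rfl fun p _ => Finset.sum_congr rfl fun a _ => by ring
  have s2 : ∑ a, ∑ p, ∑ f, (christoffel g p e f y : ℂ) * ((g y)⁻¹ a f : ℂ) * F y a p =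
      ∑ a, ∑ p, ∑ f, ((g y)⁻¹ a p : ℂ) * ((christoffel g f e p y : ℂ) * F y a f) := by
    refine Finset.sum_congr rfl fun a _ => ?_
    rw [Finset.sum_comm]
    exact Finset.sum_congr rfl fun p _ => Finset.sum_congr rfl fun f _ => by ring
  rw [l]
  simp only [contract, hg.pderiv_inv hy, mul_sub, Finset.mul_sum, Finset.sum_sub_distrib, ← s1,
    ← s2]
  push_cast
  simp only [sub_mul, neg_mul, Finset.sum_mul, Finset.sum_add_distrib, Finset.sum_sub_distrib,
    Finset.sum_neg_distrib]
  ring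

theorem differentiable_contract {F : E4 → Fin 4 → Fin 4 → ℂ}
    (hF : ∀ a p, DifferentiableAt ℝ (fun z => F z a p) y) :
    DifferentiableAt ℝ (fun z => contract (g z)⁻¹ (F z)) y := by
  have h2 : ∀ a p, DifferentiableAt ℝ (fun z => (((g z)⁻¹ a p : ℝ) : ℂ)) y := fun a p =>
    (contDiffAt_ofReal (hg.smooth_inv hy a p)).differentiableAt (by simp)
  unfold contract
  fun_prop

end SmoothMetricOn

/-- The action of the connection coefficients on a covariant tensor of rank four. -/
def connection (g : E4 → Matrix (Fin 4) (Fin 4) ℝ) (e : Fin 4) (y : E4) (S : Tensor4 ℂ) :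
    Tensor4 ℂ := fun a b c d =>
  ∑ f, ((christoffel g f e a y : ℂ) * S f b c d + (christoffel g f e b y : ℂ) * S a f c d
    + (christoffel g f e c y : ℂ) * S a b f d + (christoffel g f e d y : ℂ) * S a b c f)

theorem covDeriv_eq (g : E4 → Matrix (Fin 4) (Fin 4) ℝ) (T : E4 → Tensor4 ℂ)
    (a b c d e : Fin 4) (y : E4) : covDeriv g T a b c d e y =
      pderiv e (fun z => T z a b c d) y - connection g e y (T y) a b c d := rfl

namespace SmoothMetricOn
variable {O : Set E4} {g : E4 → Matrix (Fin 4) (Fin 4) ℝ} (hg : SmoothMetricOn O g) {y : E4}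
  (hy : y ∈ O) {T : E4 → Tensor4 ℂ} (hT : ∀ a b c d, DifferentiableAt ℝ (fun z => T z a b c d) y)
include hg hy hT

/-- The covariant derivative of a Weyl-like tensor field is Weyl-like. -/
theorem covDeriv_isWeylLike (hW : ∀ z ∈ O, IsWeylLike (g z) (T z)) (e : Fin 4) :
    IsWeylLike (g y) fun a b c d => covDeriv g T a b c d e y := by
  have hWy := hW y hy
  have right : ∀ a b c d, covDeriv g T a b d c e y = -covDeriv g T a b c d e y :=
    fun a b c d => by
      have h : connection g e y (T y) a b d c = -connection g e y (T y) a b c d := by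
        rw [connection, connection, ← Finset.sum_neg_distrib]
        refine Finset.sum_congr rfl fun f _ => ?_
        rw [hWy.antisymm_right f b c d, hWy.antisymm_right a f c d, hWy.antisymm_right a b c f,
          hWy.antisymm_right a b f d]
        ring
      rw [covDeriv_eq, covDeriv_eq, h,
        hg.pderiv_congr hy fun z hz => (hW z hz).antisymm_right a b c d, pderiv_neg]
      ring
  refine ⟨fun a b c d => ?_, right, fun a b c d => ?_, fun a b c d => ?_, fun b d => ?_⟩
  · have h : connection g e y (T y) b a c d = -connection g e y (T y) a b c d := by
      rw [connection, connection, ← Finset.sum_neg_distrib]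
      refine Finset.sum_congr rfl fun f _ => ?_
      rw [hWy.antisymm_left f b c d, hWy.antisymm_left a f c d, hWy.antisymm_left a b c f,
        hWy.antisymm_left a b f d]
      ring
    rw [covDeriv_eq, covDeriv_eq, h,
      hg.pderiv_congr hy fun z hz => (hW z hz).antisymm_left a b c d, pderiv_neg]
    ring
  · have h : connection g e y (T y) c d a b = connection g e y (T y) a b c d := by
      rw [connection, connection]
      refine Finset.sum_congr rfl fun f _ => ?_
      rw [hWy.pair_symm f b c d, hWy.pair_symm a f c d, hWy.pair_symm a b c f,
        hWy.pair_symm a b f d]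
      ring
    rw [covDeriv_eq, covDeriv_eq, h,
      hg.pderiv_congr hy fun z hz => (hW z hz).pair_symm a b c d]
  · have cyc : covDeriv g T a b c d e y + covDeriv g T a c d b e y
        + covDeriv g T a d b c e y = 0 := by
      have h : connection g e y (T y) a b c d + connection g e y (T y) a c d b
          + connection g e y (T y) a d b c = 0 := by
        simp only [connection, ← Finset.sum_add_distrib]
        refine Finset.sum_eq_zero fun f _ => ?_
        linear_combination (christoffel g f e a y : ℂ) * hWy.cyclic f b c d
          + (christoffel g f e b y : ℂ) * hWy.cyclic a f c d
          + (christoffel g f e c y : ℂ) * hWy.cyclic a b f d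
          + (christoffel g f e d y : ℂ) * hWy.cyclic a b c f
      have h' : pderiv e (fun z => T z a b c d + T z a c d b + T z a d b c) y = 0 :=
        (hg.pderiv_congr hy (h := fun _ => 0) fun z hz => (hW z hz).cyclic a b c d).trans
          pderiv_const
      rw [pderiv_add ((hT _ _ _ _).fun_add (hT _ _ _ _)) (hT _ _ _ _),
        pderiv_add (hT _ _ _ _) (hT _ _ _ _)] at h'
      simp only [covDeriv_eq]
      linear_combination h' - h
    simp only [antisymBCD]
    rw [right a b c d, right a c d b, right a d b c, Complex.real_smul]
    push_cast
    linear_combination (1 / 3 : ℂ) * cyc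
  -- Metric compatibility is applied to the vanishing trace; the connection terms acting on `b` and
  -- `d` are themselves traces of `T` and vanish.
  · have h0 : ∀ z ∈ O, ∀ b d, contract (g z)⁻¹ (fun a c => T z a b c d) = 0 := fun z hz b d => by
      rw [← trace13_eq_contract, (hW z hz).traceFree]
    have h1 : pderiv e (fun z => contract (g z)⁻¹ fun a c => T z a b c d) y = 0 :=
      (hg.pderiv_congr hy (h := fun _ => 0) fun z hz => h0 z hz b d).trans pderiv_const
    rw [hg.pderiv_contract hy e fun a c => hT a b c d] at h1
    rw [trace13_eq_contract]
    simp only [covDeriv, Finset.sum_add_distrib, contract_sub, contract_add, contract_sum,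
      contract_const_mul, h0 y hy, mul_zero, Finset.sum_const_zero, add_zero] at h1 ⊢
    linear_combination h1

/-- The derivative of the square of a tensor field in terms of its covariant derivative. -/
theorem pderiv_contract4_self (e : Fin 4) :
    pderiv e (fun z => contract4 (g z)⁻¹ (T z) (T z)) y =
      2 * contract4 (g y)⁻¹ (T y) (fun a b c d => covDeriv g T a b c d e y) := by
  have hs := inv_symm (hg.symm y hy)
  have h0 : ∀ a b c d p q r s, DifferentiableAt ℝ (fun z => T z a b c d * T z p q r s) y :=
    fun a b c d p q r s => (hT a b c d).fun_mul (hT p q r s)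
  have h1 := fun b c d q r s => hg.differentiable_contract hy
    (F := fun z a p => T z a b c d * T z p q r s) fun a p => h0 a b c d p q r s
  have h2 := fun c d r s => hg.differentiable_contract hy (F := fun z b q => contract (g z)⁻¹
    fun a p => T z a b c d * T z p q r s) fun b q => h1 b c d q r s
  have h3 := fun d s => hg.differentiable_contract hy (F := fun z c r => contract (g z)⁻¹
    fun b q => contract (g z)⁻¹ fun a p => T z a b c d * T z p q r s) fun c r => h2 c d r s
  have p0 := fun b c d q r s => hg.pderiv_contract hy e
    (F := fun z a p => T z a b c d * T z p q r s) fun a p => h0 a b c d p q r s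
  have p1 := fun c d r s => hg.pderiv_contract hy e (F := fun z b q => contract (g z)⁻¹
    fun a p => T z a b c d * T z p q r s) fun b q => h1 b c d q r s
  have p2 := fun d s => hg.pderiv_contract hy e (F := fun z c r => contract (g z)⁻¹
    fun b q => contract (g z)⁻¹ fun a p => T z a b c d * T z p q r s) fun c r => h2 c d r s
  have p3 := hg.pderiv_contract hy e (F := fun z d s => contract (g z)⁻¹ fun c r =>
    contract (g z)⁻¹ fun b q => contract (g z)⁻¹ fun a p => T z a b c d * T z p q r s) h3
  have m : ∀ (r : ℝ) (v w : ℂ), v * ((r : ℂ) * w) = (r : ℂ) * (v * w) := fun r v w => by ring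
  have hD : 2 * contract4 (g y)⁻¹ (T y) (fun a b c d => covDeriv g T a b c d e y) =
      contract4 (g y)⁻¹ (fun a b c d => covDeriv g T a b c d e y) (T y) +
      contract4 (g y)⁻¹ (T y) (fun a b c d => covDeriv g T a b c d e y) := by
    rw [contract4_comm hs (fun a b c d => covDeriv g T a b c d e y)]; ring
  rw [hD]
  unfold contract4
  rw [p3]
  -- The Christoffel terms produced by compatibility in each of the four index pairs are those that
  -- complete the two partial derivatives of `T` to covariant ones.
  simp only [p2, p1, p0, pderiv_mul (hT _ _ _ _) (hT _ _ _ _), covDeriv, sub_mul, mul_sub,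
    Finset.sum_mul, Finset.mul_sum, add_mul, mul_add, Finset.sum_add_distrib, contract_sub,
    contract_add, contract_sum, contract_const_mul, mul_assoc, m]
  ring

end SmoothMetricOn

/-- `u_a W_{ebcd} - g_{ea} u^f W_{fbcd}`. -/
def coordShear (g : Matrix (Fin 4) (Fin 4) ℝ) (W : Tensor4 ℂ) (u : Fin 4 → ℂ) : Tensor5 :=
  fun a b c d e => u a * W e b c d - (g e a : ℂ) * contract g⁻¹ fun f l => W f b c d * u l

/-- The change of the covariant derivative of `W` under a conformal change of the metric. -/
def coordShift (g : Matrix (Fin 4) (Fin 4) ℝ) (W : Tensor4 ℂ) (u : Fin 4 → ℂ) : Tensor5 :=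
  fun a b c d e => -2 * (u e * W a b c d) - (coordShear g W u a b c d e
    - coordShear g W u b a c d e + coordShear g W u c d a b e - coordShear g W u d c a b e)

/-! ### The shift in an orthonormal frame. -/

section Frame

variable {E : Matrix (Fin 4) (Fin 4) ℂ} {g : Matrix (Fin 4) (Fin 4) ℝ}
  (hE : ∀ a p, (g⁻¹ a p : ℂ) = ∑ i, E a i * E p i) (hg : IsUnit g.det)
  (W : Tensor4 ℂ) (u : Fin 4 → ℂ)
include hE hg

/-- From `g E Eᵀ = 1` it follows that `Eᵀ g E = 1`, since one-sided inverses of square matrices are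
two-sided. -/
theorem frame1_metric (i m : Fin 4) :
    frame1 E m (fun e => frame1 E i fun a => (g e a : ℂ)) = if m = i then 1 else 0 := by
  have h1 : g⁻¹.map Complex.ofReal = E * E.transpose := by
    ext a p
    simp [Matrix.mul_apply, hE]
  have h2 : g.map Complex.ofReal * g⁻¹.map Complex.ofReal = 1 := by
    ext a b
    have := congrArg Complex.ofReal (sum_mul_inv hg a b)
    by_cases hab : a = b <;> simpa [Matrix.mul_apply, Matrix.one_apply, hab] using this
  have h3 : E.transpose * (g.map Complex.ofReal * E) = 1 := by
    rw [mul_eq_one_comm, Matrix.mul_assoc, ← h1, h2]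
  have h4 := congrFun (congrFun h3 m) i
  rw [Matrix.one_apply] at h4
  rw [← h4]
  simp only [frame1, Matrix.mul_apply, Matrix.transpose_apply, Matrix.map_apply, mul_comm]

theorem frame5_coordShear :
    frame5 E (coordShear g W u) = shear (frame4 E W) (fun i => frame1 E i u) := by
  have h1 : frame5 E (fun a b c d e => u a * W e b c d) =
      fun i j k l m => frame1 E i u * frame4 E W m j k l := by
    have : (fun a b c d e => u a * W e b c d) = swapAE fun a b c d e => u e * W a b c d := rfl
    rw [this, frame5_swapAE]
    funext i j k l m
    simp only [swapAE, frame5, frame1_const_mul, frame1_mul_const, frame4]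
  have h2 : frame5 E (fun a b c d e => (g e a : ℂ) * contract g⁻¹ fun f l => W f b c d * u l) =
      fun i j k l m => (if m = i then 1 else 0) *
        ∑ n, frame1 E n u * frame4 E W n j k l := by
    funext i j k l m
    simp only [frame5, frame1_const_mul, frame1_mul_const, frame1_metric hE hg, contract_mul hE,
      frame1_sum, frame4]
    simp only [mul_comm]
  funext i j k l m
  have h3 := congrFun (congrFun (congrFun (congrFun (congrFun h1 i) j) k) l) m
  have h4 := congrFun (congrFun (congrFun (congrFun (congrFun h2 i) j) k) l) m
  simp only [frame5] at h3 h4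
  simp only [frame5, coordShear, frame1_sub, h3, h4, shear, ite_mul, one_mul, zero_mul]

theorem frame5_coordShift :
    frame5 E (coordShift g W u) = shift (frame4 E W) (fun i => frame1 E i u) := by
  have h := frame5_coordShear hE hg W u
  set X := coordShear g W u with hX
  have h1 : frame5 E (fun a b c d e => -2 * (u e * W a b c d)) =
      fun i j k l m => -2 * (frame1 E m u * frame4 E W i j k l) := by
    funext i j k l m
    simp only [frame5, frame1_const_mul, frame1_mul_const, frame4]
  have hsub : ∀ X Y : Tensor5, frame5 E (fun a b c d e => X a b c d e - Y a b c d e) =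
      fun i j k l m => frame5 E X i j k l m - frame5 E Y i j k l m := fun X Y => by
    funext i j k l m
    simp only [frame5, frame1_sub]
  have hadd : ∀ X Y : Tensor5, frame5 E (fun a b c d e => X a b c d e + Y a b c d e) =
      fun i j k l m => frame5 E X i j k l m + frame5 E Y i j k l m := fun X Y => by
    funext i j k l m
    simp only [frame5, frame1_add]
  have h2 : coordShift g W u = fun a b c d e => (fun a b c d e => -2 * (u e * W a b c d)) a b c d e
      - (fun a b c d e => (fun a b c d e => (fun a b c d e => X a b c d e
        - (fun a b c d e => X b a c d e) a b c d e) a b c d e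
        + (fun a b c d e => X c d a b e) a b c d e) a b c d e
        - (fun a b c d e => X d c a b e) a b c d e) a b c d e := rfl
  rw [h2, hsub, h1, hsub, hadd, hsub]
  funext i j k l m
  beta_reduce
  rw [frame5_ab E X, frame5_exchange E X,
    frame5_cd E (fun a b c d e => X c d a b e), frame5_exchange E X, h]
  rfl

end Frame

theorem IsWeylLike.frame1 {g : Matrix (Fin 4) (Fin 4) ℝ} (E : Matrix (Fin 4) (Fin 4) ℂ)
    (m : Fin 4) {D : Tensor5} (hD : ∀ e, IsWeylLike g fun a b c d => D a b c d e) :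
    IsWeylLike g fun a b c d => ConformalInvariants.frame1 E m fun e => D a b c d e where
  antisymm_left a b c d := by
    rw [← frame1_neg]
    exact congrArg _ (funext fun e => (hD e).antisymm_left a b c d)
  antisymm_right a b c d := by
    rw [← frame1_neg]
    exact congrArg _ (funext fun e => (hD e).antisymm_right a b c d)
  pair_symm a b c d := congrArg _ (funext fun e => (hD e).pair_symm a b c d)
  bianchi a b c d := by
    have h : ConformalInvariants.frame1 E m
        (fun e => antisymBCD (fun a b c d => D a b c d e) a b c d) = 0 := by
      simp only [(hD _).bianchi, frame1_zero]
    simp only [antisymBCD, Complex.real_smul, frame1_const_mul, frame1_add, frame1_sub] at h ⊢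
    exact h
  traceFree b d := by
    have h : ∀ e, contract g⁻¹ (fun a c => D a b c d e) = 0 := fun e => by
      rw [← (hD e).traceFree b d, trace13_eq_contract]
    rw [trace13_eq_contract]
    simp only [ConformalInvariants.frame1, contract_sum, contract_const_mul, h, mul_zero,
      Finset.sum_const_zero]

theorem WI1_eq_contract4 (g : E4 → Matrix (Fin 4) (Fin 4) ℝ) (y : E4) :
    WI1 g y = contract4 (g y)⁻¹ (W g y) (W g y) := sum_eq_contract4 _ _ _

theorem WI3_eq_contract5 (g : E4 → Matrix (Fin 4) (Fin 4) ℝ) (y : E4) :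
    WI3 g y = contract5 (g y)⁻¹ (fun a b c d e => covDeriv g (W g) a b c d e y)
      (fun a b c d e => covDeriv g (W g) a b c d e y) := sum_eq_contract5 _ _ _

theorem WI3a_eq_contract5 (g : E4 → Matrix (Fin 4) (Fin 4) ℝ) (y : E4) :
    WI3a g y = contract5 (g y)⁻¹ (fun a b c d e => covDeriv g (W g) a b c d e y)
      (swapAE fun a b c d e => covDeriv g (W g) a b c d e y) := sum_eq_contract5 _ _ _

theorem contract4_smul_metric (r : ℝ) (h : Matrix (Fin 4) (Fin 4) ℝ) (A B : Tensor4 ℂ) :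
    contract4 (r • h) A B = (r : ℂ) ^ 4 * contract4 h A B := by
  simp only [contract4, contract_smul, contract_const_mul]
  ring

theorem contract5_smul_metric (r : ℝ) (h : Matrix (Fin 4) (Fin 4) ℝ) (X Y : Tensor5) :
    contract5 (r • h) X Y = (r : ℂ) ^ 5 * contract5 h X Y := by
  simp only [contract5, contract_smul, contract_const_mul]
  ring

theorem contract4_const_mul (k : ℂ) (h : Matrix (Fin 4) (Fin 4) ℝ) (A B : Tensor4 ℂ) :
    contract4 h (fun a b c d => k * A a b c d) (fun a b c d => k * B a b c d) =
      k ^ 2 * contract4 h A B := by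
  have m : ∀ v w : ℂ, k * v * (k * w) = k ^ 2 * (v * w) := fun v w => by ring
  simp only [contract4, m, contract_const_mul]

theorem contract5_const_mul (k : ℂ) (h : Matrix (Fin 4) (Fin 4) ℝ) (X Y : Tensor5) :
    contract5 h (fun a b c d e => k * X a b c d e) (fun a b c d e => k * Y a b c d e) =
      k ^ 2 * contract5 h X Y := by
  have m : ∀ v w : ℂ, k * v * (k * w) = k ^ 2 * (v * w) := fun v w => by ring
  simp only [contract5, m, contract_const_mul]

theorem SmoothMetricOn.differentiable_contract4 {O : Set E4} {g : E4 → Matrix (Fin 4) (Fin 4) ℝ}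
    (hg : SmoothMetricOn O g) {y : E4} (hy : y ∈ O) {A B : E4 → Tensor4 ℂ}
    (hA : ∀ a b c d, DifferentiableAt ℝ (fun z => A z a b c d) y)
    (hB : ∀ a b c d, DifferentiableAt ℝ (fun z => B z a b c d) y) :
    DifferentiableAt ℝ (fun z => contract4 (g z)⁻¹ (A z) (B z)) y :=
  hg.differentiable_contract hy (F := fun z d s => contract (g z)⁻¹ fun c r => contract (g z)⁻¹
    fun b q => contract (g z)⁻¹ fun a p => A z a b c d * B z p q r s) fun d s =>
  hg.differentiable_contract hy (F := fun z c r => contract (g z)⁻¹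
    fun b q => contract (g z)⁻¹ fun a p => A z a b c d * B z p q r s) fun c r =>
  hg.differentiable_contract hy (F := fun z b q => contract (g z)⁻¹
    fun a p => A z a b c d * B z p q r s) fun b q =>
  hg.differentiable_contract hy (F := fun z a p => A z a b c d * B z p q r s) fun a p =>
    (hA a b c d).fun_mul (hB p q r s)

/-! ### Conformal change of `∇W` and of the scalar invariants. -/

namespace ConformalOn

variable {O : Set E4} {g g' : E4 → Matrix (Fin 4) (Fin 4) ℝ} {u : E4 → ℝ}
  (H : ConformalOn O g g' u) {y : E4} (hy : y ∈ O)
include H hy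

/-- Differentiating `e^{2u}` contributes `2 u_e T`, and the change of the Christoffel symbols
contributes `-u_e T` in each of the four slots, whence the coefficient `-2`. The rest of that change
gives one shear per slot, once the Weyl symmetries move the affected index to the front. -/
theorem covDeriv_eq {T T' : E4 → Tensor4 ℂ}
    (hT : ∀ a b c d, DifferentiableAt ℝ (fun z => T z a b c d) y) (hW : IsWeylLike (g y) (T y))
    (hTT : ∀ z ∈ O, T' z = fun a b c d => Real.exp (2 * u z) • T z a b c d)
    (a b c d e : Fin 4) : covDeriv g' T' a b c d e y = (Real.exp (2 * u y) : ℂ) *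
      (covDeriv g T a b c d e y
        + coordShift (g y) (T y) (fun i => ((pderiv i u y : ℝ) : ℂ)) a b c d e) := by
  have hu := H.differentiable hy
  have h1 : pderiv e (fun z => T' z a b c d) y = (Real.exp (2 * u y) : ℂ) *
      (pderiv e (fun z => T z a b c d) y + 2 * ((pderiv e u y : ℝ) : ℂ) * T y a b c d) := by
    have h : ∀ z ∈ O, T' z a b c d = ((Real.exp (2 * u z) : ℝ) : ℂ) * T z a b c d := fun z hz => by
      simp only [hTT z hz, Complex.real_smul]
    have hd : DifferentiableAt ℝ (fun z => Real.exp (2 * u z)) y := by fun_prop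
    have hd' : DifferentiableAt ℝ (fun z => ((Real.exp (2 * u z) : ℝ) : ℂ)) y :=
      Complex.ofRealCLM.differentiableAt.comp y hd
    rw [H.base.pderiv_congr hy h, pderiv_mul hd' (hT a b c d), pderiv_ofReal hd,
      pderiv_exp_two_mul hu]
    push_cast
    ring
  have h2 : ∀ (x : Fin 4) (S : Fin 4 → ℂ), ∑ f, (christoffel g' f e x y : ℂ) * S f =
      (∑ f, (christoffel g f e x y : ℂ) * S f) + ((pderiv e u y : ℝ) : ℂ) * S x
        + ((pderiv x u y : ℝ) : ℂ) * S e
        - (g y e x : ℂ) * contract (g y)⁻¹ fun f l => S f * ((pderiv l u y : ℝ) : ℂ) := by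
    intro x S
    have : ∀ f, (christoffel g' f e x y : ℂ) * S f = (christoffel g f e x y : ℂ) * S f
        + (if f = x then ((pderiv e u y : ℝ) : ℂ) * S f else 0)
        + (if f = e then ((pderiv x u y : ℝ) : ℂ) * S f else 0)
        - (g y e x : ℂ) * ∑ l, ((g y)⁻¹ f l : ℂ) * (S f * ((pderiv l u y : ℝ) : ℂ)) := fun f => by
      have s : ∑ l, ((g y)⁻¹ f l : ℂ) * (S f * ((pderiv l u y : ℝ) : ℂ)) =
          S f * ∑ l, ((g y)⁻¹ f l : ℂ) * ((pderiv l u y : ℝ) : ℂ) := by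
        rw [Finset.mul_sum]; exact Finset.sum_congr rfl fun l _ => by ring
      rw [s, H.christoffel_eq hy]
      push_cast
      split_ifs <;> push_cast <;> ring
    simp only [this, Finset.sum_add_distrib, Finset.sum_sub_distrib, contract, Finset.mul_sum]
    simp
  have e2 : (fun f l => T y a f c d * ((pderiv l u y : ℝ) : ℂ)) =
      fun f l => (-1 : ℂ) * (T y f a c d * ((pderiv l u y : ℝ) : ℂ)) := by
    funext f l; rw [hW.antisymm_left f a c d]; ring
  have e3 : (fun f l => T y a b f d * ((pderiv l u y : ℝ) : ℂ)) =
      fun f l => T y f d a b * ((pderiv l u y : ℝ) : ℂ) := by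
    funext f l; rw [hW.pair_symm f d a b]
  have e4 : (fun f l => T y a b c f * ((pderiv l u y : ℝ) : ℂ)) =
      fun f l => (-1 : ℂ) * (T y f c a b * ((pderiv l u y : ℝ) : ℂ)) := by
    funext f l; rw [← hW.pair_symm a b c f, hW.antisymm_left f c a b]; ring
  have hS := hTT y hy
  simp only [covDeriv, h1, hS, Complex.real_smul, Finset.sum_add_distrib]
  have hc : ∀ (r v w : ℂ), r * (v * w) = v * (r * w) := fun r v w => by ring
  simp only [mul_left_comm _ ((Real.exp (2 * u y) : ℝ) : ℂ), ← Finset.mul_sum]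
  rw [h2 a fun f => T y f b c d, h2 b fun f => T y a f c d, h2 c fun f => T y a b f d,
    h2 d fun f => T y a b c f, e2, e3, e4]
  simp only [coordShift, coordShear, contract_const_mul]
  rw [hW.antisymm_left e a c d, hW.pair_symm e d a b, ← hW.pair_symm a b c e,
    hW.antisymm_left e c a b]
  ring

/-- The weight `e^{-4u}` is written as `exp (2 * (-2 * u))` so that `pderiv_exp_two_mul` applies
with `-2 * u` in place of `u`. -/
theorem WI1_eq : WI1 g' y = ((Real.exp (2 * (-2 * u y)) : ℝ) : ℂ) * WI1 g y := by
  rw [WI1_eq_contract4, WI1_eq_contract4, H.W_eq hy, H.inv_eq hy, contract4_smul_metric]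
  simp only [Complex.real_smul]
  rw [contract4_const_mul]
  have h : ((Real.exp (2 * (-2 * u y)) : ℝ) : ℂ) = ((Real.exp (2 * u y))⁻¹ : ℝ) ^ 4 *
      ((Real.exp (2 * u y) : ℝ) : ℂ) ^ 2 := by
    rw [← Real.exp_neg, ← Complex.ofReal_pow, ← Complex.ofReal_pow, ← Complex.ofReal_mul,
      ← Real.exp_nat_mul, ← Real.exp_nat_mul, ← Real.exp_add]
    congr 2
    push_cast
    ring
  rw [h, mul_assoc]

theorem WJ4_eq (hI : I1 g y ≠ 0) {E : Matrix (Fin 4) (Fin 4) ℂ}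
    (hE : ∀ a p, ((g y)⁻¹ a p : ℂ) = ∑ i, E a i * E p i) :
    WJ4 g' y = ((Real.exp (-10 * u y) : ℝ) : ℂ) * WJ4 g y := by
  have hG := H.base
  have hgy := hG.nondeg y hy
  have hW := hG.W_isWeylLike hy
  have hT : ∀ a b c d, DifferentiableAt ℝ (fun z => W g z a b c d) y := fun a b c d =>
    (hG.smooth_W hy hI a b c d).differentiableAt (by simp)
  have hu := H.differentiable hy
  have hs := inv_symm (hG.symm y hy)
  set v : Fin 4 → ℂ := fun i => ((pderiv i u y : ℝ) : ℂ) with hv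
  set D : Tensor5 := fun a b c d e => covDeriv g (W g) a b c d e y with hD
  set S : Tensor5 := coordShift (g y) (W g y) v with hS
  set h := (g y)⁻¹ with hh
  set r : ℝ := (Real.exp (2 * u y))⁻¹ with hr
  have hr0 : r * Real.exp (2 * u y) = 1 := inv_mul_cancel₀ (Real.exp_pos _).ne'
  have hc : (r : ℂ) * ((Real.exp (2 * u y) : ℝ) : ℂ) = 1 := by
    rw [← Complex.ofReal_mul, hr0, Complex.ofReal_one]
  have hD' : (fun a b c d e => covDeriv g' (W g') a b c d e y) =
      fun a b c d e => ((Real.exp (2 * u y) : ℝ) : ℂ) * (D + S) a b c d e := by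
    funext a b c d e
    exact H.covDeriv_eq hy hT hW (fun z hz => H.W_eq hz) a b c d e
  -- Five inverse metrics contribute `r^5` and the two tensors `r^{-2}`, where `r = e^{-2u}`.
  have hsc : ∀ X Y : Tensor5, contract5 (g' y)⁻¹
      (fun a b c d e => ((Real.exp (2 * u y) : ℝ) : ℂ) * X a b c d e)
      (fun a b c d e => ((Real.exp (2 * u y) : ℝ) : ℂ) * Y a b c d e) =
      (r : ℂ) ^ 3 * contract5 h X Y := fun X Y => by
    rw [H.inv_eq hy, contract5_smul_metric, contract5_const_mul]
    linear_combination (r : ℂ) ^ 3 * contract5 h X Y *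
      ((r : ℂ) * ((Real.exp (2 * u y) : ℝ) : ℂ) + 1) * hc
  have e3' : WI3 g' y = (r : ℂ) ^ 3 * contract5 h (D + S) (D + S) := by
    rw [WI3_eq_contract5, hD', hsc]
  have e3a' : WI3a g' y = (r : ℂ) ^ 3 * contract5 h (D + S) (swapAE (D + S)) := by
    rw [WI3a_eq_contract5, hD', ← hsc]
    rfl
  have e3 : WI3 g y = contract5 h D D := WI3_eq_contract5 g y
  have e3a : WI3a g y = contract5 h D (swapAE D) := WI3a_eq_contract5 g y
  have hdW : DifferentiableAt ℝ (WI1 g) y := by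
    rw [funext (WI1_eq_contract4 g)]
    exact hG.differentiable_contract4 hy hT hT
  have hd1 : ∀ e, pderiv e (WI1 g) y = 2 * contract4 h (W g y) (fun a b c d => D a b c d e) :=
    fun e => by
      rw [funext (WI1_eq_contract4 g)]
      exact hG.pderiv_contract4_self hy hT e
  have e1' : WI1 g' y = (r : ℂ) ^ 2 * WI1 g y := by
    rw [H.WI1_eq hy, hr, ← Real.exp_neg, ← Complex.ofReal_pow, ← Real.exp_nat_mul]
    congr 3
    push_cast
    ring
  have hd1' : ∀ e, pderiv e (WI1 g') y =
      (r : ℂ) ^ 2 * (pderiv e (WI1 g) y - 4 * WI1 g y * v e) := fun e => by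
    have hd : DifferentiableAt ℝ (fun z => Real.exp (2 * (-2 * u z))) y := by fun_prop
    have hd' : DifferentiableAt ℝ (fun z => ((Real.exp (2 * (-2 * u z)) : ℝ) : ℂ)) y :=
      Complex.ofRealCLM.differentiableAt.comp y hd
    have hr2 : Real.exp (2 * (-2 * u y)) = r ^ 2 := by
      rw [hr, ← Real.exp_neg, ← Real.exp_nat_mul]
      congr 1
      push_cast
      ring
    rw [hG.pderiv_congr hy fun z hz => H.WI1_eq hz, pderiv_mul hd' hdW, pderiv_ofReal hd,
      pderiv_exp_two_mul (hu.const_mul (-2)), pderiv_const_mul hu, hr2, hv]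
    push_cast
    ring
  have e5 : WI5 g y = contract h fun a b => pderiv a (WI1 g) y * pderiv b (WI1 g) y := rfl
  have e5' : WI5 g' y = (r : ℂ) ^ 5 * (WI5 g y
      - 8 * WI1 g y * (contract h fun a b => pderiv a (WI1 g) y * v b)
      + 16 * WI1 g y ^ 2 * contract h fun a b => v a * v b) := by
    have h1 : WI5 g' y =
        contract (g' y)⁻¹ fun a b => pderiv a (WI1 g') y * pderiv b (WI1 g') y := rfl
    have h2 : (fun a b => pderiv a (WI1 g') y * pderiv b (WI1 g') y) = fun a b =>
        (r : ℂ) ^ 4 * (pderiv a (WI1 g) y * pderiv b (WI1 g) y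
          - 4 * WI1 g y * (pderiv a (WI1 g) y * v b) - 4 * WI1 g y * (pderiv b (WI1 g) y * v a)
          + 16 * WI1 g y ^ 2 * (v a * v b)) := by
      funext a b
      rw [hd1', hd1']
      ring
    rw [h1, h2, H.inv_eq hy, contract_smul, contract_const_mul, contract_add, contract_sub,
      contract_sub, contract_const_mul, contract_const_mul, contract_const_mul, e5,
      contract_swap hs fun a b => pderiv b (WI1 g) y * v a]
    ring
  -- As `d ᵂI₁ = 2 ⟨W, ∇W⟩`, the cross term of `ᵂI₅` is twice the contraction that survives in
  -- `key`.
  have eR : (contract h fun a b => pderiv a (WI1 g) y * v b) =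
      2 * contract5 h D (fun a b c d e => v e * W g y a b c d) := by
    have : contract5 h D (fun a b c d e => v e * W g y a b c d) = contract h fun e t =>
        v t * contract4 h (fun a b c d => D a b c d e) (W g y) := by
      simp only [contract5, contract4, mul_left_comm _ (v _), contract_const_mul]
    rw [this, ← contract_const_mul]
    refine congrArg _ (funext fun a => funext fun b => ?_)
    rw [hd1, contract4_comm hs]
    ring
  have hFW := frame4_isEuclideanWeyl hE rfl hW
  have hFD : IsEuclideanWeyl5 (frame5 E D) := by
    intro m
    have h2 : (fun i j k l => frame5 E D i j k l m) = frame4 E fun a b c d =>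
        frame1 E m fun e => D a b c d e := by
      funext i j k l
      exact frame5_eq_frame4' E D i j k l m
    rw [h2]
    exact frame4_isEuclideanWeyl hE rfl (IsWeylLike.frame1 E m
      (hG.covDeriv_isWeylLike hy hT fun z hz => hG.W_isWeylLike hz))
  have hadd : frame5 E (D + S) = frame5 E D + shift (frame4 E (W g y)) fun i => frame1 E i v := by
    rw [← frame5_coordShift hE hgy]
    funext i j k l m
    simp only [frame5, Pi.add_apply, frame1_add, hS]
  have key := six_inner5_sub_sixteen_inner5_swapAE hFW hFD fun i => frame1 E i v
  rw [← hadd, ← frame5_swapAE, ← frame5_swapAE, ← contract5_eq_inner5 hE, ← contract5_eq_inner5 hE,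
    ← contract5_eq_inner5 hE, ← contract5_eq_inner5 hE, ← contract4_eq_inner4 hE,
    ← contract_mul hE] at key
  have hU : (fun i j k l m => frame1 E m v * frame4 E (W g y) i j k l) =
      frame5 E fun a b c d e => v e * W g y a b c d := by
    funext i j k l m
    simp only [frame5, frame1_const_mul, frame1_mul_const, frame4]
  rw [hU, ← contract5_eq_inner5 hE, ← WI1_eq_contract4] at key
  have hr5 : ((Real.exp (-10 * u y) : ℝ) : ℂ) = (r : ℂ) ^ 5 := by
    rw [hr, ← Real.exp_neg, ← Complex.ofReal_pow, ← Real.exp_nat_mul]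
    congr 2
    push_cast
    ring
  rw [WJ4, WJ4, e1', e3', e3a', e5', e3, e3a, eR, hr5]
  -- All three summands carry `r^5`, and the changes of `ᵂI₅` cancel those of `6 ᵂI₃ - 16 ᵂI₃ₐ`
  -- multiplied by `ᵂI₁`.
  linear_combination (r : ℂ) ^ 5 * WI1 g y * key

end ConformalOn

/-- The Minkowski matrix. -/
def minkowski : Matrix (Fin 4) (Fin 4) ℝ := Matrix.diagonal fun i => if i = 0 then -1 else 1

theorem minkowski_mul_self : minkowski * minkowski = 1 := by
  rw [minkowski, Matrix.diagonal_mul_diagonal, ← Matrix.diagonal_one]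
  congr 1
  funext i
  split_ifs <;> norm_num

/-! ### Complex orthonormal frames from congruence with the Minkowski matrix. -/

section Congruence

variable {g P : Matrix (Fin 4) (Fin 4) ℝ} (h : P.transpose * g * P = minkowski)
include h

theorem congruence_mul_eq_one : P * minkowski * P.transpose * g = 1 := by
  have h1 : (minkowski * P.transpose * g) * P = 1 := by
    rw [← minkowski_mul_self, ← h]
    simp only [Matrix.mul_assoc]
  rw [mul_eq_one_comm] at h1
  rw [← h1]
  simp only [Matrix.mul_assoc]

theorem isUnit_det_of_congruence : IsUnit g.det := by
  have h1 := congrArg Matrix.det (congruence_mul_eq_one h)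
  rw [Matrix.det_mul, Matrix.det_one] at h1
  exact IsUnit.of_mul_eq_one_right _ h1

/-- A real matrix congruent to the Minkowski matrix has a complex orthonormal frame. -/
theorem exists_complex_frame : ∃ E : Matrix (Fin 4) (Fin 4) ℂ, ∀ a p,
    (g⁻¹ a p : ℂ) = ∑ i, E a i * E p i := by
  -- The inverse metric is `P η Pᵀ` with `η` the Minkowski matrix; multiplying the timelike column
  -- by `i` absorbs its minus sign.
  refine ⟨Matrix.of fun a i => (P a i : ℂ) * if i = 0 then Complex.I else 1, fun a p => ?_⟩
  rw [Matrix.inv_eq_left_inv (congruence_mul_eq_one h), minkowski, Matrix.mul_apply]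
  simp only [Matrix.mul_diagonal, Matrix.transpose_apply, Matrix.of_apply]
  push_cast
  refine Finset.sum_congr rfl fun i _ => ?_
  split_ifs
  · push_cast
    linear_combination -((P a i : ℂ) * (P p i : ℂ)) * Complex.I_mul_I
  · push_cast
    ring

end Congruence

/-! ### From the Lorentzian manifold to matrix fields in a chart. -/

section Manifold

variable {M : Type*} [TopologicalSpace M] [ChartedSpace E4 M]

theorem mfderiv_chart_symm_surjective {φ : OpenPartialHomeomorph M E4}
    (hφ : φ ∈ IsManifold.maximalAtlas (𝓡 4) ∞ M) {y : E4} (hy : y ∈ φ.target) :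
    Function.Surjective (mfderiv (𝓡 4) (𝓡 4) φ.symm y) := by
  have h : φ.MDifferentiable (𝓡 4) (𝓡 4) :=
    ⟨(contMDiffOn_of_mem_maximalAtlas hφ).mdifferentiableOn (by simp),
      (contMDiffOn_symm_of_mem_maximalAtlas hφ).mdifferentiableOn (by simp)⟩
  exact h.symm.mfderiv_surjective hy

variable [IsManifold (𝓡 4) ∞ M] (g : LorentzMetric M) {φ : OpenPartialHomeomorph M E4}
  (hφ : φ ∈ IsManifold.maximalAtlas (𝓡 4) ∞ M)
include hφ

/-- The component matrix of a Lorentz metric is congruent to the Minkowski matrix. -/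
theorem LorentzMetric.exists_congruence {y : E4} (hy : y ∈ φ.target) :
    ∃ P : Matrix (Fin 4) (Fin 4) ℝ, P.transpose * g.inChart φ y * P = minkowski := by
  obtain ⟨b, hb⟩ := g.lorentzian (φ.symm y)
  let L : E4 →L[ℝ] TangentSpace (𝓡 4) (φ.symm y) := mfderiv (𝓡 4) (𝓡 4) φ.symm y
  -- The coordinate components of the pseudo-orthonormal basis vectors are the columns of `P`.
  have hL : ∀ i, ∃ w : E4, L w = b i := fun i => mfderiv_chart_symm_surjective hφ hy (b i)
  choose v hv using hL
  refine ⟨Matrix.of fun a i => v i a, ?_⟩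
  have hexp : ∀ i, b i = ∑ a, v i a • L (EuclideanSpace.single a (1 : ℝ)) := by
    intro i
    have : v i = ∑ a, v i a • (EuclideanSpace.single a (1 : ℝ) : E4) := by
      ext k
      simp [Pi.single_apply]
    rw [← hv i]
    conv_lhs => rw [this]
    simp only [map_sum, map_smul]
  ext i j
  have h := hb i j
  rw [hexp i, hexp j] at h
  simp only [map_sum, LinearMap.sum_apply, map_smul, LinearMap.smul_apply, smul_eq_mul] at h
  rw [minkowski, Matrix.diagonal_apply, ← h]
  simp only [Matrix.mul_apply, Matrix.transpose_apply, Matrix.of_apply, LorentzMetric.inChart,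
    metricComponent, Finset.sum_mul, Finset.mul_sum]
  refine Finset.sum_congr rfl fun a _ => Finset.sum_congr rfl fun c _ => ?_
  change v i c * g.form (φ.symm y) (L (EuclideanSpace.single c (1 : ℝ)))
    (L (EuclideanSpace.single a (1 : ℝ))) * v j a = _
  ring

theorem LorentzMetric.smoothMetricOn : SmoothMetricOn φ.target (g.inChart φ) where
  isOpen := φ.open_target
  smooth y hy i j := (g.smooth φ hφ i j).contDiffAt (φ.open_target.mem_nhds hy)
  symm y _ i j := g.symm _ _ _
  nondeg y hy := by
    obtain ⟨P, hP⟩ := g.exists_congruence hφ hy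
    exact isUnit_det_of_congruence hP

theorem LorentzMetric.conformalOn (g' : LorentzMetric M) {U : M → ℝ}
    (hU : ContMDiff (𝓡 4) 𝓘(ℝ, ℝ) ∞ U)
    (hconf : ∀ (x : M) (v w : TangentSpace (𝓡 4) x),
      g'.form x v w = Real.exp (2 * U x) * g.form x v w) :
    ConformalOn φ.target (g.inChart φ) (g'.inChart φ) (U ∘ φ.symm) where
  base := g.smoothMetricOn hφ
  smooth y hy := by
    have h : ContMDiffOn 𝓘(ℝ, E4) 𝓘(ℝ, ℝ) ∞ (U ∘ φ.symm) φ.target :=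
      hU.comp_contMDiffOn (contMDiffOn_symm_of_mem_maximalAtlas hφ)
    exact (contMDiffOn_iff_contDiffOn.1 h).contDiffAt (φ.open_target.mem_nhds hy)
  eq_smul y _ := by
    ext i j
    exact hconf _ _ _

end Manifold
end ConformalInvariants
end

open ConformalInvariants in
theorem mainTheorem2 {M : Type*} [TopologicalSpace M] [ChartedSpace E4 M]
    [IsManifold (𝓡 4) ∞ M] (g g' : LorentzMetric M) (U : M → ℝ)
    (hU : ContMDiff (𝓡 4) 𝓘(ℝ, ℝ) ∞ U)
    (hconf : ∀ (x : M) (v w : TangentSpace (𝓡 4) x),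
      g'.form x v w = Real.exp (2 * U x) * g.form x v w)
    (φ : OpenPartialHomeomorph M E4) (hφ : φ ∈ IsManifold.maximalAtlas (𝓡 4) ∞ M)
    (x : M) (hx : x ∈ φ.source) (hI : I1 (g.inChart φ) (φ x) ≠ 0) :
    IsWeylLike (g.inChart φ (φ x)) (W (g.inChart φ) (φ x)) ∧
    (∀ a b c d, ContDiffAt ℝ ∞ (fun y => W (g.inChart φ) y a b c d) (φ x)) ∧
    (∀ a b c d, W (g'.inChart φ) (φ x) a b c d =
      (Real.exp (2 * U x) : ℂ) * W (g.inChart φ) (φ x) a b c d) ∧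
    WJ4 (g'.inChart φ) (φ x) = (Real.exp (-10 * U x) : ℂ) * WJ4 (g.inChart φ) (φ x) := by
  have hy : φ x ∈ φ.target := φ.map_source hx
  have H := g.conformalOn hφ g' hU hconf
  have hUx : (U ∘ φ.symm) (φ x) = U x := congrArg U (φ.left_inv hx)
  obtain ⟨P, hP⟩ := g.exists_congruence hφ hy
  obtain ⟨E, hE⟩ := exists_complex_frame hP
  refine ⟨H.base.W_isWeylLike hy, H.base.smooth_W hy hI, fun a b c d => ?_, ?_⟩
  · simp only [H.W_eq hy, hUx, Complex.real_smul]
  · rw [H.WJ4_eq hy hI hE, hUx]
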